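/- **Paths, loops, distances.** Let $\mathcal F$ be the set of functions $f:[0,t_f]\to\mathbb R^2$ with $t_f\ge 0$. For $f,g\in\mathcal F$ put $d_\infty(f,g)=|t_f-t_g|+\sup_{t\ge0}|f(t\wedge t_f)-g(t\wedge t_g)|$, $$\rho(f,g)=\inf_\varphi\Big\{\sup_{[0,t_f]}|f-g\circ\varphi|+\tfrac12\big(\sup_{[0,t_f]}|\varphi-\mathrm{Id}|+\sup_{[0,t_g]}|\varphi^{-1}-\mathrm{Id}|\big)\Big\},$$ with $\varphi$ ranging over the increasing continuous bijections $[0,t_f]\to[0,t_g]$ ($\rho=\infty$ if there is none), and $\omega_\delta(f)=\sup\{|f(s)-f(t)|: s,t\in[0,t_f],\ |s-t|\le\delta\}$. A *simple path* is a continuous injective $\gamma\in\mathcal F$; a *loop* is a continuous $\ell\in\mathcal F$ with $\ell(0)=\ell(t_\ell)$. Consider pairs $\mathcal X=(\gamma,\mathcal L)$ of a simple path $\gamma$ and a multiset $\mathcal L$ of loops (with finite multiplicities) that is locally finite for $d_\infty$ on the space of loops of positive duration. Elements of $\mathcal L$ are counted with multiplicity. Let $\omega_\delta(\mathcal L)=\sup_{\ell\in\mathcal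 L}\omega_\delta(\ell)$, let $\mathcal L_\gamma$ consist of the $\ell\in\mathcal L$ whose range meets that of $\gamma$, and for $\ell\in\mathcal L_\gamma$ let $$\sigma_\ell=\min\{\sigma:\gamma(\sigma)\in\mathrm{Range}(\ell)\},\quad x_\ell=\gamma(\sigma_\ell),\quad \Theta_\ell=\{t\in[0,t_\ell]:\ell(t)=x_\ell\}.$$ **Regular loops.** For $0<\sigma<t_\gamma$ and $x=\gamma(\sigma)$, let $r$ be the distance from $x$ to $\{\gamma(0),\gamma(t_\gamma)\}$, and let $\sigma^-$ (resp. $\sigma^+$) be the last time before (resp. first time after) $\sigma$ at which $\gamma$ is on the circle $\partial B_r(x)$. Closing $\gamma|_{[\sigma^-,\sigma^+]}$ by the anticlockwise arc of $\partial B_r(x)$ from $\gamma(\sigma^+)$ to $\gamma(\sigma^-)$ gives a simple closed curve; let $L(x)$ and $R(x)$ be the bounded and the unbounded component of its complement. A loop $\ell$ meeting $\gamma$ is *regular for $\gamma$* if $\Theta_\ell=\{\theta_\ell\}$ is a singleton, $\sigma_\ell\notin\{0,t_\gamma\}$, and for every $\varepsilon>0$ there are times $\theta^L,\theta^R\in[\theta_\ell-\varepsilon,\theta_\ell+\varepsilon]\cap[0,t_\ell]$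 with $\ell(\theta^L)\in L(x_\ell)$ and $\ell(\theta^R)\in R(x_\ell)$. **The sets $\mathcal R\subseteq\mathcal R_0$ and $\mathcal R'$.** $\mathcal X\in\mathcal R_0$ if (i) $\sum_{\ell\in\mathcal L_\gamma}t_\ell<\infty$, and $\{\ell\in\mathcal L:t_\ell\ge\varepsilon\}$ is finite for all $\varepsilon>0$; and (ii) for all $\varepsilon>0$ there is $\delta>0$ with $\omega_\delta(\mathcal L)<\varepsilon$. $\mathcal X\in\mathcal R$ if moreover (iii) $\ell\mapsto\sigma_\ell$ is injective on $\mathcal L_\gamma$ and every $\Theta_\ell$, $\ell\in\mathcal L_\gamma$, is a singleton; (iv) $\{\sigma_\ell:\ell\in\mathcal L_\gamma\}$ is dense in $[0,t_\gamma]$; (v) every $\ell\in\mathcal L_\gamma$ is regular for $\gamma$. Let $\mathcal R'=(\mathcal R\times\{0\})\cup(\mathcal R_0\times(0,\infty))$. **The attachment map.** A *tie-break* $B\in\mathcal B_{\mathcal X}$ consists of a total order on each set $\{\ell\in\mathcal L_\gamma:\sigma_\ell=\sigma\}$ and of a choice of $\theta_\ell\in\Theta_\ell$ for each $\ell\in\mathcal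 L_\gamma$. Order $\mathcal L_\gamma$ by $\sigma_\ell$, and loops with equal $\sigma_\ell$ by $B$; call $\prec$ the resulting strict total order. For $\lambda\ge0$ let $$t_{\mathcal X,\lambda}=\sum_{\ell\in\mathcal L_\gamma}t_\ell+\lambda t_\gamma,\qquad T_\ell=\sum_{\ell'\prec\ell}t_{\ell'}+\lambda\sigma_\ell,\qquad \mathcal T=\bigsqcup_{\ell\in\mathcal L_\gamma}(T_\ell,T_\ell+t_\ell).$$ Then $X=\Xi(\mathcal X,\lambda,B):[0,t_{\mathcal X,\lambda}]\to\mathbb R^2$ is given by $X(t)=\ell\big((t-T_\ell+\theta_\ell)\bmod t_\ell\big)$ if $t\in(T_\ell,T_\ell+t_\ell)$, and by $X(t)=\gamma\big((1-\mu)\sigma_-+\mu\sigma_+\big)$ if $t\notin\mathcal T$, where $$t_-=0\vee\sup\{T_\ell+t_\ell:T_\ell+t_\ell\le t\},\quad t_+=t_{\mathcal X,\lambda}\wedge\inf\{T_\ell:T_\ell\ge t\},$$ $$\sigma_-=0\vee\sup\{\sigma_\ell:T_\ell+t_\ell\le t\},\quad \sigma_+=t_\gamma\wedge\inf\{\sigma_\ell:T_\ell\ge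 t\}$$ (suprema and infima over $\ell\in\mathcal L_\gamma$), and $\mu=0$ if $t_-=t_+$, $\mu=(t-t_-)/(t_+-t_-)$ otherwise. If $\mathcal X\in\mathcal R$, then $\mathcal B_{\mathcal X}$ has a single element $B$, and $\Xi(\mathcal X):=\Xi(\mathcal X,0,B)$. **The distance $d_{\mathcal R_0}$.** For $\delta>0$, a *$\delta$-isomorphism* from $\mathcal L$ to $\mathcal L'$ is a bijection $\phi:\mathcal L_0\to\mathcal L_0'$ between sub-multisets of $\mathcal L$ and $\mathcal L'$ such that $\mathcal L_0$ and $\mathcal L'_0$ contain all loops of duration at least $\delta$ of $\mathcal L$, resp. $\mathcal L'$, every $\ell\in\mathcal L_0$ satisfies $t_\ell\ge\delta$ or $t_{\phi(\ell)}\ge\delta$, and $d_\infty(\ell,\phi(\ell))\le\delta/2$ for all $\ell\in\mathcal L_0$. Let $d(\mathcal L,\mathcal L')$ be the infimum of the $\delta>0$ for which a $\delta$-isomorphism from $\mathcal L$ to $\mathcal L'$ exists, and $$d_{\mathcal R_0}(\mathcal X,\mathcal X')=\rho(\gamma,\gamma')+d(\mathcal L,\mathcal L')+|t_{\mathcal X,0}-t_{\mathcal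 X',0}|+\sup_{\delta\in[0,1]}|\omega_\delta(\mathcal L)-\omega_\delta(\mathcal L')|.$$ **Theorem 4.11.** The map $\Xi$ is continuous on $\mathcal R\times\{0\}$ in the following sense. For all $\mathcal X\in\mathcal R$ and all $\varepsilon>0$ there exists $\delta>0$ such that for all $(\mathcal X',\lambda)\in\mathcal R'$ with $d_{\mathcal R_0}(\mathcal X,\mathcal X')\le\delta$ and $\lambda\le\delta$, and for all $B\in\mathcal B_{\mathcal X'}$, $$d_\infty\big(\Xi(\mathcal X',\lambda,B),\Xi(\mathcal X)\big)<\varepsilon.$$ -/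

import Mathlib

namespace LoopAttachment

/-! The plane is identified with `ℂ`. -/

/-- A function `[0, dur] → ℝ²`, together with its duration `dur ≥ 0`. -/
structure TimedFun where
  dur : ℝ
  dur_nonneg : 0 ≤ dur
  toFun : Set.Icc (0 : ℝ) dur → ℂ

namespace TimedFun

/-- The function frozen outside its domain; for `t ≥ 0` the value is `f (min t f.dur)`. -/
noncomputable def ext (f : TimedFun) : ℝ → ℂ := Set.IccExtend f.dur_nonneg f.toFun

def range (f : TimedFun) : Set ℂ := Set.range f.toFun

/-- `d_∞(f, g) = |t_f - t_g| + sup_{t ≥ 0} |f(t ∧ t_f) - g(t ∧ t_g)|`. -/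
noncomputable def dInf (f g : TimedFun) : ENNReal :=
  edist f.dur g.dur + ⨆ t : {t : ℝ // 0 ≤ t}, edist (f.ext t) (g.ext t)

/-- `ρ(f, g)`, the infimum over all increasing bijections `φ : [0, t_f] → [0, t_g]` (these are
automatically continuous). It is `∞` when there is none, i.e. when exactly one of the durations
vanishes. -/
noncomputable def rho (f g : TimedFun) : ENNReal :=
  ⨅ φ : Set.Icc (0 : ℝ) f.dur ≃o Set.Icc (0 : ℝ) g.dur,
    (⨆ t, edist (f.toFun t) (g.toFun (φ t))) +
      ((⨆ t, edist (φ t : ℝ) (t : ℝ)) + ⨆ s, edist (φ.symm s : ℝ) (s : ℝ)) / 2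

/-- The continuity modulus `ω_δ(f)`. -/
noncomputable def modulus (δ : ℝ) (f : TimedFun) : ENNReal :=
  ⨆ (s : Set.Icc (0 : ℝ) f.dur) (t : Set.Icc (0 : ℝ) f.dur) (_ : |(s : ℝ) - t| ≤ δ),
    edist (f.toFun s) (f.toFun t)

end TimedFun

/-- Continuous simple paths of finite duration. -/
structure SimplePath extends TimedFun where
  continuous_toFun : Continuous toFun
  injective_toFun : Function.Injective toFun

/-- Rooted continuous loops of finite duration. -/
structure Loop extends TimedFun where
  continuous_toFun : Continuous toFun
  closed : toFun ⟨0, Set.left_mem_Icc.2 dur_nonneg⟩ = toFun ⟨dur, Set.right_mem_Icc.2 dur_nonneg⟩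

/-- A multiset of loops (a counting measure, given by its multiplicities), locally finite on the
space of loops of positive duration. -/
structure LoopFamily where
  mult : Loop → ℕ
  locallyFinite : ∀ ℓ : Loop, 0 < ℓ.dur →
    ∃ r : ENNReal, 0 < r ∧ {ℓ' : Loop | mult ℓ' ≠ 0 ∧ ℓ.dInf ℓ'.toTimedFun < r}.Finite

/-- The elements of the multiset, counted with multiplicity. -/
def LoopFamily.Elem (L : LoopFamily) : Type := Σ ℓ : Loop, Fin (L.mult ℓ)

/-- `ω_δ(L) = sup_{ℓ ∈ L} ω_δ(ℓ)`. -/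
noncomputable def LoopFamily.modulus (δ : ℝ) (L : LoopFamily) : ENNReal :=
  ⨆ e : L.Elem, e.1.toTimedFun.modulus δ

section Intersection

def Meets (γ : SimplePath) (ℓ : Loop) : Prop := (ℓ.range ∩ γ.range).Nonempty

/-- The first hitting time `σ_{γ,ℓ}`. -/
noncomputable def firstHit (γ : SimplePath) (ℓ : Loop) : ℝ :=
  sInf {σ : ℝ | σ ∈ Set.Icc 0 γ.dur ∧ γ.ext σ ∈ ℓ.range}

/-- The set `Θ_{γ,ℓ}` of temporal roots. -/
def roots (γ : SimplePath) (ℓ : Loop) : Set ℝ :=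
  {t : ℝ | t ∈ Set.Icc 0 ℓ.dur ∧ ℓ.ext t = γ.ext (firstHit γ ℓ)}

/-! The two sides of `γ` around the point `x = γ(σ)`, for `0 < σ < t_γ`. -/

/-- `r(x)`, the distance from `x` to the two endpoints of `γ`. -/
noncomputable def sideRadius (γ : SimplePath) (σ : ℝ) : ℝ :=
  min (dist (γ.ext σ) (γ.ext 0)) (dist (γ.ext σ) (γ.ext γ.dur))

/-- Last time before `σ` at which `γ` is on the circle of centre `x` and radius `r(x)`. -/
noncomputable def lastEntry (γ : SimplePath) (σ : ℝ) : ℝ :=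
  sSup {s : ℝ | s ∈ Set.Icc 0 γ.dur ∧ s < σ ∧ γ.ext s ∈ Metric.sphere (γ.ext σ) (sideRadius γ σ)}

/-- First time after `σ` at which `γ` is on the circle of centre `x` and radius `r(x)`. -/
noncomputable def firstExit (γ : SimplePath) (σ : ℝ) : ℝ :=
  sInf {s : ℝ | s ∈ Set.Icc 0 γ.dur ∧ σ < s ∧ γ.ext s ∈ Metric.sphere (γ.ext σ) (sideRadius γ σ)}

/-- The arc of the circle of centre `x` through `a` which goes anticlockwise from `a` until it
first reaches `b`. -/
def anticlockwiseArc (x a b : ℂ) : Set ℂ :=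
  {z : ℂ | ∃ s : ℝ, 0 ≤ s ∧ z = x + (a - x) * Complex.exp (s * Complex.I) ∧
    ∀ u : ℝ, 0 ≤ u → u < s → x + (a - x) * Complex.exp (u * Complex.I) ≠ b}

/-- The range of the simple closed curve made of the piece of `γ` between `lastEntry` and
`firstExit` and of the anticlockwise arc from the exit point back to the entry point. -/
noncomputable def sideCurve (γ : SimplePath) (σ : ℝ) : Set ℂ :=
  γ.ext '' Set.Icc (lastEntry γ σ) (firstExit γ σ) ∪
    anticlockwiseArc (γ.ext σ) (γ.ext (firstExit γ σ)) (γ.ext (lastEntry γ σ))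

/-- `L(x)`: the bounded connected component of the complement of the closed curve. -/
def leftSide (γ : SimplePath) (σ : ℝ) : Set ℂ :=
  {z : ℂ | z ∉ sideCurve γ σ ∧
    Bornology.IsBounded (connectedComponentIn (sideCurve γ σ)ᶜ z)}

/-- `R(x)`: the unbounded connected component of the complement of the closed curve. -/
def rightSide (γ : SimplePath) (σ : ℝ) : Set ℂ :=
  {z : ℂ | z ∉ sideCurve γ σ ∧
    ¬ Bornology.IsBounded (connectedComponentIn (sideCurve γ σ)ᶜ z)}

/-- The loop `ℓ` is regular for `γ`. -/
structure IsRegular (γ : SimplePath) (ℓ : Loop) : Prop where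
  meets : Meets γ ℓ
  firstHit_ne_zero : firstHit γ ℓ ≠ 0
  firstHit_ne_dur : firstHit γ ℓ ≠ γ.dur
  /-- there is a unique temporal root, and the intersection there is bilateral -/
  bilateral : ∃ θ : ℝ, roots γ ℓ = {θ} ∧ ∀ ε : ℝ, 0 < ε →
    (∃ t ∈ Set.Icc (θ - ε) (θ + ε) ∩ Set.Icc 0 ℓ.dur, ℓ.ext t ∈ leftSide γ (firstHit γ ℓ)) ∧
    (∃ t ∈ Set.Icc (θ - ε) (θ + ε) ∩ Set.Icc 0 ℓ.dur, ℓ.ext t ∈ rightSide γ (firstHit γ ℓ))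

end Intersection

/-- A pair `𝒳 = (γ, ℒ)`. -/
structure PathLoops where
  path : SimplePath
  loops : LoopFamily

namespace PathLoops

/-- The elements (with multiplicity) of `ℒ_γ`, i.e. the loops which meet `γ`. -/
def Hit (X : PathLoops) : Type := {e : X.loops.Elem // Meets X.path e.1}

variable {X : PathLoops}

def Hit.loop (e : X.Hit) : Loop := e.1.1

/-- The first hitting time `σ_ℓ`. -/
noncomputable def Hit.time (e : X.Hit) : ℝ := firstHit X.path e.loop

/-- The set of pairs `ℛ₀`. -/
structure MemR0 (X : PathLoops) : Prop where
  summable_dur : Summable fun e : X.Hit => e.loop.dur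
  finite_large : ∀ ε : ℝ, 0 < ε → {e : X.loops.Elem | ε ≤ e.1.dur}.Finite
  equicontinuous : ∀ ε : ENNReal, 0 < ε → ∃ δ : ℝ, 0 < δ ∧ X.loops.modulus δ < ε

/-- The set of pairs `ℛ`. -/
structure MemR (X : PathLoops) : Prop extends MemR0 X where
  injective_time : Function.Injective fun e : X.Hit => e.time
  unique_root : ∀ e : X.Hit, ∃ θ : ℝ, roots X.path e.loop = {θ}
  dense_times : Set.Icc 0 X.path.dur ⊆ closure (Set.range fun e : X.Hit => e.time)
  regular : ∀ e : X.Hit, IsRegular X.path e.loop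

/-- The set `ℛ' = (ℛ × {0}) ∪ (ℛ₀ × (0, ∞))`. -/
def MemR' (X : PathLoops) (lam : ℝ) : Prop := (X.MemR ∧ lam = 0) ∨ (X.MemR0 ∧ 0 < lam)

/-- Tie-breaks: a (strict) total order on each set of loops with a given first hitting time, and a
temporal root for each loop of `ℒ_γ`. -/
structure TieBreak (X : PathLoops) where
  before : ∀ σ : ℝ, {e : X.Hit // e.time = σ} → {e : X.Hit // e.time = σ} → Prop
  isStrictTotalOrder : ∀ σ : ℝ, IsStrictTotalOrder _ (before σ)
  root : X.Hit → ℝ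
  root_mem : ∀ e : X.Hit, root e ∈ roots X.path e.loop

/-- The total time `t_{𝒳,λ}`. -/
noncomputable def totalTime (X : PathLoops) (lam : ℝ) : ℝ :=
  (∑' e : X.Hit, e.loop.dur) + lam * X.path.dur

namespace TieBreak

/-- The strict total order `≺_{γ,B}`: first by hitting time, then by the order given by `B`. -/
def prec (B : TieBreak X) (e e' : X.Hit) : Prop :=
  e.time < e'.time ∨ ∃ h : e.time = e'.time, B.before e'.time ⟨e, h⟩ ⟨e', rfl⟩

/-- The starting time `T_ℓ`. -/
noncomputable def start (B : TieBreak X) (lam : ℝ) (e : X.Hit) : ℝ :=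
  (∑' e' : {e' : X.Hit // B.prec e' e}, e'.1.loop.dur) + lam * e.time

/-- The end time `T_ℓ + t_ℓ`. -/
noncomputable def finish (B : TieBreak X) (lam : ℝ) (e : X.Hit) : ℝ :=
  B.start lam e + e.loop.dur

/-- The rerooted loop `t ↦ ℓ(t + θ_ℓ mod t_ℓ)`, for `0 ≤ t ≤ t_ℓ`. -/
noncomputable def rerooted (B : TieBreak X) (e : X.Hit) (t : ℝ) : ℂ :=
  if t + B.root e ≤ e.loop.dur then e.loop.ext (t + B.root e)
  else e.loop.ext (t + B.root e - e.loop.dur)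

/-! The position along `γ` at a time `t` outside of all intervals `(T_ℓ, T_ℓ + t_ℓ)`. The suprema
and infima are of the form `a ∨ sup S = sup (S ∪ {a})` and `b ∧ inf S = inf (S ∪ {b})`. -/

noncomputable def tMinus (B : TieBreak X) (lam t : ℝ) : ℝ :=
  sSup (insert 0 {u : ℝ | ∃ e : X.Hit, B.finish lam e ≤ t ∧ u = B.finish lam e})

noncomputable def tPlus (B : TieBreak X) (lam t : ℝ) : ℝ :=
  sInf (insert (X.totalTime lam) {u : ℝ | ∃ e : X.Hit, t ≤ B.start lam e ∧ u = B.start lam e})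

noncomputable def sigmaMinus (B : TieBreak X) (lam t : ℝ) : ℝ :=
  sSup (insert 0 {u : ℝ | ∃ e : X.Hit, B.finish lam e ≤ t ∧ u = e.time})

noncomputable def sigmaPlus (B : TieBreak X) (lam t : ℝ) : ℝ :=
  sInf (insert X.path.dur {u : ℝ | ∃ e : X.Hit, t ≤ B.start lam e ∧ u = e.time})

open Classical in
/-- The interpolation parameter `μ(t)`. -/
noncomputable def mu (B : TieBreak X) (lam t : ℝ) : ℝ :=
  if B.tMinus lam t = B.tPlus lam t then 0
  else (t - B.tMinus lam t) / (B.tPlus lam t - B.tMinus lam t)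

/-- `σ_{𝒳,λ}(t)` for `t` outside of all intervals `(T_ℓ, T_ℓ + t_ℓ)`. -/
noncomputable def sigma (B : TieBreak X) (lam t : ℝ) : ℝ :=
  (1 - B.mu lam t) * B.sigmaMinus lam t + B.mu lam t * B.sigmaPlus lam t

end TieBreak

open Classical in
/-- The path `Ξ(𝒳, λ, B)` at time `t`: it follows the rerooted loop `ℓ` during the interval
`(T_ℓ, T_ℓ + t_ℓ)` (these intervals are pairwise disjoint), and `γ` at all other times. -/
noncomputable def attachAt (X : PathLoops) (lam : ℝ) (B : TieBreak X) (t : ℝ) : ℂ :=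
  if h : ∃ e : X.Hit, t ∈ Set.Ioo (B.start lam e) (B.finish lam e) then
    B.rerooted h.choose (t - B.start lam h.choose)
  else X.path.ext (B.sigma lam t)

theorem totalTime_nonneg (X : PathLoops) {lam : ℝ} (h : 0 ≤ lam) : 0 ≤ X.totalTime lam :=
  add_nonneg (tsum_nonneg fun e => e.loop.dur_nonneg) (mul_nonneg h X.path.dur_nonneg)

theorem MemR'.nonneg {lam : ℝ} (h : X.MemR' lam) : 0 ≤ lam := by
  rcases h with ⟨_, h⟩ | ⟨_, h⟩
  · exact h.ge
  · exact h.le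

/-- The attachment map `Ξ(𝒳, λ, B)`, for `λ ≥ 0`. -/
noncomputable def attach (X : PathLoops) (lam : ℝ) (hlam : 0 ≤ lam) (B : TieBreak X) : TimedFun where
  dur := X.totalTime lam
  dur_nonneg := X.totalTime_nonneg hlam
  toFun t := X.attachAt lam B t

/-! When there is no tie, there is exactly one tie-break. -/

theorem roots_nonempty {γ : SimplePath} {ℓ : Loop} (h : Meets γ ℓ) : (roots γ ℓ).Nonempty := by
  have hγ : Continuous γ.ext := γ.continuous_toFun.Icc_extend'
  have hcl : IsClosed {σ : ℝ | σ ∈ Set.Icc 0 γ.dur ∧ γ.ext σ ∈ ℓ.range} := by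
    have hr : IsClosed ℓ.range := (isCompact_range ℓ.continuous_toFun).isClosed
    exact isClosed_Icc.inter (hr.preimage hγ)
  have hne : {σ : ℝ | σ ∈ Set.Icc 0 γ.dur ∧ γ.ext σ ∈ ℓ.range}.Nonempty := by
    obtain ⟨z, hz, ⟨s, hs⟩⟩ := h
    refine ⟨s, s.2, ?_⟩
    rw [TimedFun.ext, Set.IccExtend_val, hs]
    exact hz
  have hmem := hcl.csInf_mem hne ⟨0, fun σ hσ => hσ.1.1⟩
  obtain ⟨t, ht⟩ := hmem.2
  refine ⟨t, t.2, ?_⟩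
  rw [TimedFun.ext, Set.IccExtend_val, ht]
  rfl

theorem TieBreak.nonempty (X : PathLoops) : Nonempty (TieBreak X) :=
  ⟨{ before := fun _ => WellOrderingRel
     isStrictTotalOrder := fun _ => inferInstance
     root := fun e => (roots_nonempty e.2).choose
     root_mem := fun e => (roots_nonempty e.2).choose_spec }⟩

theorem MemR.subsingleton_tieBreak (h : X.MemR) : Subsingleton (TieBreak X) := by
  constructor
  intro B B'
  have hb : B.before = B'.before := by
    funext σ e e'
    have hee : e = e' := Subtype.ext (h.injective_time (e.2.trans e'.2.symm))
    subst hee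
    have h1 := B.isStrictTotalOrder σ
    have h2 := B'.isStrictTotalOrder σ
    exact propext ⟨fun k => absurd k (irrefl_of (B.before σ) e),
      fun k => absurd k (irrefl_of (B'.before σ) e)⟩
  have hr : B.root = B'.root := by
    funext e
    obtain ⟨θ, hθ⟩ := h.unique_root e
    have h1 := B.root_mem e
    have h2 := B'.root_mem e
    rw [hθ] at h1 h2
    exact h1.trans h2.symm
  cases B
  cases B'
  cases hb
  cases hr
  rfl

/-- `Ξ(𝒳) = Ξ(𝒳, 0, B)` for `𝒳 ∈ ℛ`, where `B` is the unique tie-break. -/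
noncomputable def MemR.attach (_h : X.MemR) : TimedFun :=
  X.attach 0 le_rfl (Classical.choice (TieBreak.nonempty X))

end PathLoops

/-- A `δ`-isomorphism between two multisets of loops: a bijection between sub-multisets which
contain all the loops of duration at least `δ`. -/
structure DeltaIso (δ : ℝ) (L L' : LoopFamily) where
  source : Set L.Elem
  target : Set L'.Elem
  toEquiv : source ≃ target
  mem_source : ∀ e : L.Elem, δ ≤ e.1.dur → e ∈ source
  mem_target : ∀ e' : L'.Elem, δ ≤ e'.1.dur → e' ∈ target
  source_subset : ∀ e : source, δ ≤ e.1.1.dur ∨ δ ≤ (toEquiv e).1.1.dur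
  close : ∀ e : source, e.1.1.dInf (toEquiv e).1.1.toTimedFun ≤ ENNReal.ofReal (δ / 2)

/-- `d(ℒ, ℒ')`. -/
noncomputable def LoopFamily.d (L L' : LoopFamily) : ENNReal :=
  ⨅ (δ : ℝ) (_ : 0 < δ) (_ : Nonempty (DeltaIso δ L L')), ENNReal.ofReal δ

/-- `|a - b|` for `a, b ∈ [0, ∞]`. -/
noncomputable def absDiff (a b : ENNReal) : ENNReal := max (a - b) (b - a)

/-- The distance `d_{ℛ₀}`. -/
noncomputable def PathLoops.dR0 (X X' : PathLoops) : ENNReal :=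
  X.path.rho X'.path.toTimedFun + X.loops.d X'.loops
    + edist (X.totalTime 0) (X'.totalTime 0)
    + ⨆ δ : Set.Icc (0 : ℝ) 1, absDiff (X.loops.modulus δ) (X'.loops.modulus δ)

end LoopAttachment

/-! Finitely many loops of `X` carry almost all of the total duration, and they can be chosen with
hitting times forming a fine net in `[0, t_γ]`. In a nearby pair `X'` each of them has a partner
that is close to it. If the partner's hitting time and temporal roots are also close, then the order
of these loops is preserved, because hitting times in `X` are distinct. Closeness of the total
durations makes the unmatched loops of `X'` short in total as well, so the starting times of matched
loops are close. This is a `Matching` (`MemR.exists_matching`).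

The two attached paths are then compared at nearby times. If one is well inside a loop, that loop is
matched, the other path is inside the partner, and equicontinuity concludes. Otherwise both are near
positions on their paths that respect the order of visits (`exists_isPosition`). If these positions
were far apart, a matched loop of the net hit in between would be entirely over for one path and not
begun for the other, although its duration exceeds the time discrepancy
(`Matching.abs_position_sub_le`).

Stability of the hitting time (`IsRegular.stable`) is the topological core. It cannot become much
earlier, since the part of the path before it is at positive distance from the loop. It cannot
become much later, because near its root the loop visits both sides of `γ`, and this crossing
survives perturbation. For the latter, if a compact `K` separates `a` from `b` in the sense that
only `a` has a bounded component, then `(z - a) / (z - b)` has no continuous logarithm on `K`. If a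
path from near `a` to near `b` missed the perturbed `K`, moving the base point along it would
produce such a logarithm. No Jordan curve theorem is needed. -/

namespace LoopAttachment

/-! ### Continuous logarithms and separation in the plane -/

/-- Two functions are log-equivalent on `K` when they differ by the exponential of a continuous
function. -/
def LogEquiv (K : Set ℂ) (f g : ℂ → ℂ) : Prop :=
  ∃ h : ℂ → ℂ, ContinuousOn h K ∧ ∀ z ∈ K, f z = g z * Complex.exp (h z)

namespace LogEquiv

variable {K : Set ℂ} {f g k : ℂ → ℂ}

theorem symm (h : LogEquiv K f g) : LogEquiv K g f := by
  obtain ⟨h, hc, he⟩ := h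
  refine ⟨fun z => -h z, hc.neg, fun z hz => ?_⟩
  rw [he z hz, mul_assoc, ← Complex.exp_add]
  simp

theorem trans (h₁ : LogEquiv K f g) (h₂ : LogEquiv K g k) : LogEquiv K f k := by
  obtain ⟨u, hu, hu'⟩ := h₁
  obtain ⟨v, hv, hv'⟩ := h₂
  refine ⟨fun z => v z + u z, hv.add hu, fun z hz => ?_⟩
  rw [hu' z hz, hv' z hz, mul_assoc, ← Complex.exp_add]

/-- As in Rouché's theorem, the quotient `f / g` stays in the open unit disc around `1`, where the
principal logarithm is continuous. -/
theorem of_norm_sub_lt (hf : ContinuousOn f K) (hg : ContinuousOn g K)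
    (h : ∀ z ∈ K, ‖f z - g z‖ < ‖g z‖) : LogEquiv K f g := by
  have hg0 : ∀ z ∈ K, g z ≠ 0 := fun z hz h0 => by
    have := h z hz
    rw [h0, norm_zero] at this
    exact absurd this (not_lt.2 (norm_nonneg _))
  have hs : ∀ z ∈ K, f z / g z ∈ Complex.slitPlane := fun z hz => by
    have : f z / g z = 1 + (f z - g z) / g z := by
      field_simp [hg0 z hz]
      ring
    rw [this]
    apply Complex.mem_slitPlane_of_norm_lt_one
    rw [norm_div, div_lt_one (norm_pos_iff.2 (hg0 z hz))]
    exact h z hz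
  refine ⟨fun z => Complex.log (f z / g z), (hf.div hg hg0).clog hs, fun z hz => ?_⟩
  rw [Complex.exp_log (Complex.slitPlane_ne_zero (hs z hz)), mul_div_cancel₀ _ (hg0 z hz)]

/-- By compactness of `K`, the class of `G t` is locally constant in `t ∈ s`, by `of_norm_sub_lt`;
hence it is constant on a preconnected set. -/
theorem of_homotopy (hK : IsCompact K) {s : Set ℝ} (hs : IsPreconnected s) {G : ℝ → ℂ → ℂ}
    (hG : Continuous (Function.uncurry G)) (h0 : ∀ t ∈ s, ∀ z ∈ K, G t z ≠ 0) {x y : ℝ}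
    (hx : x ∈ s) (hy : y ∈ s) : LogEquiv K (G x) (G y) := by
  have hGt : ∀ t, Continuous (G t) := fun t => hG.comp (by fun_prop : Continuous fun z => (t, z))
  refine hs.induction₂ (fun x y => LogEquiv K (G x) (G y)) (fun t ht => ?_)
    (fun _ _ _ _ _ _ => LogEquiv.trans) (fun _ _ _ _ => LogEquiv.symm) hx hy
  have key : ∀ᶠ u in nhds t, ∀ z ∈ K, ‖G u z - G t z‖ < ‖G t z‖ := by
    apply hK.eventually_forall_of_forall_eventually
    intro z hz
    have h1 : Continuous fun p : ℝ × ℂ => ‖G p.1 p.2 - G t p.2‖ :=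
      (hG.sub ((hGt t).comp continuous_snd)).norm
    have h2 : Continuous fun p : ℝ × ℂ => ‖G t p.2‖ := ((hGt t).comp continuous_snd).norm
    refine (isOpen_lt h1 h2).mem_nhds ?_
    simpa using h0 t ht z hz
  filter_upwards [mem_nhdsWithin_of_mem_nhds key] with u hu
  exact (of_norm_sub_lt (hGt u).continuousOn (hGt t).continuousOn hu).symm

end LogEquiv

/-- The identity has no continuous logarithm on a circle around `0`. -/
theorem not_logEquiv_id_sphere {R : ℝ} (hR : 0 < R) (c : ℂ) :
    ¬ LogEquiv (Metric.sphere 0 R) (fun z => z) (fun _ => c) := by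
  rintro ⟨h, hc, he⟩
  have hmem : ∀ t : ℝ, (R : ℂ) * Complex.exp (t * Complex.I) ∈ Metric.sphere (0 : ℂ) R := by
    intro t
    simp [Complex.norm_exp_ofReal_mul_I, abs_of_pos hR]
  -- Since `c * exp (k t)` is constant, `k` can only move by multiples of `2πi`; yet it drops by
  -- `2πi` over one turn, so its imaginary part would pass through the forbidden value `-π`.
  set k : ℝ → ℂ := fun t => h (R * Complex.exp (t * Complex.I)) - t * Complex.I with hk
  have hkc : Continuous k := by
    have : Continuous fun t : ℝ => h (R * Complex.exp (t * Complex.I)) :=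
      hc.comp_continuous (by fun_prop) hmem
    exact this.sub (by fun_prop)
  have hk1 : ∀ t, c * Complex.exp (k t) = R := by
    intro t
    have h1 := he _ (hmem t)
    rw [hk]
    simp only [Complex.exp_sub]
    rw [← mul_div_assoc, ← h1, mul_div_assoc, div_self (Complex.exp_ne_zero _), mul_one]
  have hc0 : c ≠ 0 := fun h0 => by
    have := hk1 0
    rw [h0, zero_mul] at this
    exact hR.ne' (by exact_mod_cast this.symm)
  have hk2 : k (2 * Real.pi) = k 0 - 2 * Real.pi * Complex.I := by
    simp [hk, Complex.exp_two_pi_mul_I]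
  have him : Continuous fun t => (k t - k 0).im := Complex.continuous_im.comp (hkc.sub continuous_const)
  have hmem : -Real.pi ∈ Set.Icc (k (2 * Real.pi) - k 0).im (k 0 - k 0).im := by
    rw [hk2]
    constructor <;> simp [Real.pi_pos.le]
    linarith [Real.pi_pos]
  obtain ⟨t, -, ht⟩ := intermediate_value_Icc' (by positivity : (0 : ℝ) ≤ 2 * Real.pi)
    him.continuousOn hmem
  have hexp : Complex.exp (k t) = Complex.exp (k 0) :=
    mul_left_cancel₀ hc0 ((hk1 t).trans (hk1 0).symm)
  obtain ⟨n, hn⟩ := Complex.exp_eq_exp_iff_exists_int.1 hexp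
  have ht' : (k t - k 0).im = n * (2 * Real.pi) := by
    rw [hn]
    simp
  have h3 : ((2 * n + 1 : ℤ) : ℝ) * Real.pi = 0 := by
    push_cast
    have : (k t - k 0).im = -Real.pi := ht
    linarith
  have h4 : ((2 * n + 1 : ℤ) : ℝ) = 0 := by
    rcases mul_eq_zero.1 h3 with h | h
    · exact h
    · exact absurd h Real.pi_ne_zero
  have h5 : 2 * n + 1 = 0 := by exact_mod_cast h4
  omega

/-- A continuous nonvanishing function on the plane does not agree with `z - a` near infinity. -/
theorem not_forall_eq_sub_of_ne_zero {F : ℂ → ℂ} (hF : Continuous F) (h0 : ∀ z, F z ≠ 0) (a : ℂ)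
    (R : ℝ) : ¬ ∀ z, R < ‖z‖ → F z = z - a := by
  intro h
  -- On the circle of radius `r > ‖a‖`, `F` is log-equivalent to the identity, while `F (t * z)`
  -- contracts it to the constant `F 0`.
  set r : ℝ := max R ‖a‖ + 1 with hr
  have hrR : R < r := by have := le_max_left R ‖a‖; linarith
  have hra : ‖a‖ < r := by have := le_max_right R ‖a‖; linarith
  have hr0 : 0 < r := (norm_nonneg a).trans_lt hra
  have h1 : LogEquiv (Metric.sphere 0 r) (fun z => F ((1 : ℝ) * z)) (fun z => F ((0 : ℝ) * z)) :=
    LogEquiv.of_homotopy (isCompact_sphere 0 r) (s := Set.univ) isPreconnected_univ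
      (G := fun t z => F (t * z))
      (hF.comp (by fun_prop : Continuous fun p : ℝ × ℂ => (p.1 : ℂ) * p.2))
      (fun t _ z _ => h0 _) (Set.mem_univ _) (Set.mem_univ _)
  have h2 : LogEquiv (Metric.sphere 0 r) (fun z => F ((1 : ℝ) * z)) (fun z => z) := by
    apply LogEquiv.of_norm_sub_lt
    · exact (hF.comp (by fun_prop : Continuous fun z : ℂ => ((1 : ℝ) : ℂ) * z)).continuousOn
    · exact continuousOn_id
    · intro z hz
      have hz' : ‖z‖ = r := by simpa using hz
      simp only [Complex.ofReal_one, one_mul]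
      rw [h z (by rw [hz']; exact hrR), hz']
      simpa using hra
  have h3 := h2.symm.trans h1
  simp only [Complex.ofReal_zero, zero_mul] at h3
  exact not_logEquiv_id_sphere hr0 _ h3

/-- A frontier point off `K` has an open component which meets that of `a`, hence equals it; but an
open set contains none of its frontier. -/
theorem frontier_connectedComponentIn_compl_subset {K : Set ℂ} (hK : IsClosed K) (a : ℂ) :
    frontier (connectedComponentIn Kᶜ a) ⊆ K := by
  intro z hz
  by_contra hzK
  have hV : IsOpen (connectedComponentIn Kᶜ a) := hK.isOpen_compl.connectedComponentIn
  have hW : IsOpen (connectedComponentIn Kᶜ z) := hK.isOpen_compl.connectedComponentIn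
  have hzW : z ∈ connectedComponentIn Kᶜ z := mem_connectedComponentIn hzK
  rw [hV.frontier_eq] at hz
  obtain ⟨w, hwW, hwV⟩ := mem_closure_iff.1 hz.1 _ hW hzW
  have h1 := connectedComponentIn_eq hwW
  have h2 := connectedComponentIn_eq hwV
  exact hz.2 (h2.trans h1.symm ▸ hzW)

/-- The easy half of Borsuk's separation criterion. -/
theorem not_logEquiv_of_separated {K : Set ℂ} (hK : IsCompact K) {a b : ℂ} (ha : a ∉ K)
    (hVa : Bornology.IsBounded (connectedComponentIn Kᶜ a))
    (hVb : ¬ Bornology.IsBounded (connectedComponentIn Kᶜ b)) :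
    ¬ LogEquiv K (fun z => z - a) (fun z => z - b) := by
  classical
  rintro ⟨h, hc, he⟩
  obtain ⟨H, hH⟩ := ContinuousMap.exists_restrict_eq hK.isClosed
    (⟨K.domRestrict h, hc.domRestrict⟩ : C(K, ℂ))
  have hH' : ∀ z ∈ K, H z = h z := fun z hz => DFunLike.congr_fun hH ⟨z, hz⟩
  set V := connectedComponentIn Kᶜ a with hV
  have haV : a ∈ V := mem_connectedComponentIn ha
  have hbV : b ∉ V := fun hbV => hVb (connectedComponentIn_eq hbV ▸ hVa)
  -- The logarithm, extended by Tietze to `H`, glues the two formulas along the frontier of `V`,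
  -- which lies in `K`. As `a ∈ V` and `b ∉ V`, neither formula vanishes where it is used.
  set F : ℂ → ℂ := fun z => if z ∈ V then (z - b) * Complex.exp (H z) else z - a with hF
  have hFc : Continuous F := by
    apply Continuous.if
    · intro z hz
      have hzK : z ∈ K := frontier_connectedComponentIn_compl_subset hK.isClosed a hz
      rw [hH' z hzK]
      exact (he z hzK).symm
    · have := H.continuous
      fun_prop
    · fun_prop
  have hF0 : ∀ z, F z ≠ 0 := by
    intro z
    by_cases hz : z ∈ V
    · rw [hF]
      simp only [if_pos hz]
      refine mul_ne_zero (sub_ne_zero.2 fun h => hbV (h ▸ hz)) (Complex.exp_ne_zero _)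
    · rw [hF]
      simp only [if_neg hz]
      exact sub_ne_zero.2 fun h => hz (h ▸ haV)
  obtain ⟨R, hR⟩ := hVa.exists_norm_le
  refine not_forall_eq_sub_of_ne_zero hFc hF0 a R fun z hz => ?_
  have : z ∉ V := fun hzV => absurd (hR z hzV) (not_le.2 hz)
  simp only [hF, if_neg this]

/-- Separation is stable: if `K` separates `a` from `b`, then the image of `K` under a map close
to the identity meets every path which joins a point near `a` to a point near `b`. -/
theorem exists_mem_image_of_separated {K : Set ℂ} (hK : IsCompact K) {a b : ℂ} (ha : a ∉ K)
    (hVa : Bornology.IsBounded (connectedComponentIn Kᶜ a))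
    (hVb : ¬ Bornology.IsBounded (connectedComponentIn Kᶜ b)) {f : ℂ → ℂ} (hf : Continuous f)
    {p : ℝ → ℂ} (hp : Continuous p) (u v : ℝ)
    (hau : ∀ z ∈ K, ‖f z - z‖ + ‖p u - a‖ < ‖z - a‖)
    (hbv : ∀ z ∈ K, ‖f z - z‖ + ‖p v - b‖ < ‖z - b‖) :
    ∃ z ∈ K, ∃ w ∈ Set.uIcc u v, f z = p w := by
  -- If `p` avoids `f '' K`, then `f z - p t` is a nonvanishing homotopy; its ends are
  -- log-equivalent to `z - a` and `z - b` by the two smallness hypotheses.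
  by_contra! hcon
  refine not_logEquiv_of_separated hK ha hVa hVb ?_
  have h1 : LogEquiv K (fun z => f z - p u) (fun z => z - a) := by
    refine LogEquiv.of_norm_sub_lt (by fun_prop) (by fun_prop) fun z hz => ?_
    have : f z - p u - (z - a) = (f z - z) - (p u - a) := by ring
    rw [this]
    exact (norm_sub_le _ _).trans_lt (hau z hz)
  have h2 : LogEquiv K (fun z => f z - p v) (fun z => z - b) := by
    refine LogEquiv.of_norm_sub_lt (by fun_prop) (by fun_prop) fun z hz => ?_
    have : f z - p v - (z - b) = (f z - z) - (p v - b) := by ring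
    rw [this]
    exact (norm_sub_le _ _).trans_lt (hbv z hz)
  have h3 : LogEquiv K (fun z => f z - p u) (fun z => f z - p v) :=
    LogEquiv.of_homotopy hK (s := Set.uIcc u v) isPreconnected_uIcc (G := fun t z => f z - p t)
      (by unfold Function.uncurry; fun_prop)
      (fun t ht z hz => sub_ne_zero.2 (hcon z hz t ht)) Set.left_mem_uIcc Set.right_mem_uIcc
  exact (h1.symm.trans h3).trans h2

/-! ### Frozen extensions and first hitting times -/

namespace TimedFun

theorem ext_of_mem (f : TimedFun) {t : ℝ} (ht : t ∈ Set.Icc 0 f.dur) : f.ext t = f.toFun ⟨t, ht⟩ :=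
  Set.IccExtend_of_mem f.dur_nonneg f.toFun ht

theorem ext_coe (f : TimedFun) (t : Set.Icc (0 : ℝ) f.dur) : f.ext t = f.toFun t :=
  Set.IccExtend_val f.dur_nonneg f.toFun t

theorem ext_mem_range (f : TimedFun) (t : ℝ) : f.ext t ∈ f.range := ⟨_, rfl⟩

theorem exists_ext_eq (f : TimedFun) {z : ℂ} (hz : z ∈ f.range) :
    ∃ t ∈ Set.Icc 0 f.dur, f.ext t = z := by
  obtain ⟨t, rfl⟩ := hz
  exact ⟨t, t.2, f.ext_coe t⟩

theorem ext_eq_ext_projIcc (f : TimedFun) (t : ℝ) :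
    f.ext t = f.ext (Set.projIcc 0 f.dur f.dur_nonneg t) := by
  rw [ext_coe]
  rfl

theorem ext_of_nonpos (f : TimedFun) {t : ℝ} (ht : t ≤ 0) : f.ext t = f.ext 0 := by
  rw [ext, Set.IccExtend_of_le_left _ _ ht, Set.IccExtend_of_le_left _ _ le_rfl]

theorem continuous_ext {f : TimedFun} (hf : Continuous f.toFun) : Continuous f.ext :=
  hf.Icc_extend'

end TimedFun

theorem SimplePath.continuous_ext (γ : SimplePath) : Continuous γ.ext :=
  TimedFun.continuous_ext γ.continuous_toFun

theorem Loop.continuous_ext (ℓ : Loop) : Continuous ℓ.ext :=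
  TimedFun.continuous_ext ℓ.continuous_toFun

theorem Loop.ext_zero_eq (ℓ : Loop) : ℓ.ext 0 = ℓ.ext ℓ.dur := by
  rw [ℓ.ext_of_mem (Set.left_mem_Icc.2 ℓ.dur_nonneg),
    ℓ.ext_of_mem (Set.right_mem_Icc.2 ℓ.dur_nonneg)]
  exact ℓ.closed

theorem SimplePath.ext_injOn (γ : SimplePath) : Set.InjOn γ.ext (Set.Icc 0 γ.dur) := by
  intro s hs t ht h
  rw [γ.ext_of_mem hs, γ.ext_of_mem ht] at h
  exact congrArg Subtype.val (γ.injective_toFun h)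

theorem SimplePath.isCompact_range (γ : SimplePath) : IsCompact γ.range :=
  _root_.isCompact_range γ.continuous_toFun

theorem Loop.isCompact_range (ℓ : Loop) : IsCompact ℓ.range :=
  _root_.isCompact_range ℓ.continuous_toFun

variable {γ : SimplePath} {ℓ : Loop}

theorem firstHit_spec (h : Meets γ ℓ) :
    firstHit γ ℓ ∈ Set.Icc 0 γ.dur ∧ γ.ext (firstHit γ ℓ) ∈ ℓ.range := by
  have hcl : IsClosed {σ : ℝ | σ ∈ Set.Icc 0 γ.dur ∧ γ.ext σ ∈ ℓ.range} :=
    isClosed_Icc.inter (ℓ.isCompact_range.isClosed.preimage γ.continuous_ext)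
  obtain ⟨z, hz, hz'⟩ := h
  obtain ⟨s, hs, rfl⟩ := γ.exists_ext_eq hz'
  exact hcl.csInf_mem ⟨s, hs, hz⟩ ⟨0, fun σ hσ => hσ.1.1⟩

theorem firstHit_le {s : ℝ} (hs : s ∈ Set.Icc 0 γ.dur) (hm : γ.ext s ∈ ℓ.range) :
    firstHit γ ℓ ≤ s :=
  csInf_le ⟨0, fun _ hσ => hσ.1.1⟩ ⟨hs, hm⟩

/-! ### Compactness estimates and the geometry of the side curve -/

/-- Points of the range of a function near a value attained only once have parameters near the
parameter of that value. -/
theorem exists_forall_dist_lt_imp {f : ℝ → ℂ} (hf : Continuous f) {a b θ : ℝ}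
    (hθ : ∀ t ∈ Set.Icc a b, f t = f θ → t = θ) {η : ℝ} (hη : 0 < η) :
    ∃ ρ : ℝ, 0 < ρ ∧ ∀ t ∈ Set.Icc a b, dist (f t) (f θ) < ρ → |t - θ| < η := by
  have hc : IsCompact (f '' (Set.Icc a b ∩ {t | η ≤ |t - θ|})) :=
    (isCompact_Icc.inter_right (isClosed_le continuous_const (by fun_prop))).image hf
  have hd : Disjoint (f '' (Set.Icc a b ∩ {t | η ≤ |t - θ|})) {f θ} := by
    rw [Set.disjoint_singleton_right]
    rintro ⟨t, ⟨ht, ht'⟩, he⟩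
    rw [hθ t ht he] at ht'
    simp only [sub_self, abs_zero, Set.mem_ofPred_eq] at ht'
    linarith
  obtain ⟨r, hr, h⟩ := Metric.exists_pos_forall_lt_edist hc isClosed_singleton hd
  refine ⟨r, by exact_mod_cast hr, fun t ht htd => ?_⟩
  by_contra! hcon
  have := h _ ⟨t, ⟨ht, hcon⟩, rfl⟩ _ rfl
  rw [edist_nndist, ENNReal.coe_lt_coe, ← NNReal.coe_lt_coe, coe_nndist] at this
  linarith

theorem exists_forall_lt_dist {s t : Set ℂ} (hs : IsCompact s) (ht : IsClosed t)
    (hd : Disjoint s t) : ∃ ρ : ℝ, 0 < ρ ∧ ∀ x ∈ s, ∀ y ∈ t, ρ < dist x y := by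
  obtain ⟨r, hr, h⟩ := Metric.exists_pos_forall_lt_edist hs ht hd
  refine ⟨r, by exact_mod_cast hr, fun x hx y hy => ?_⟩
  have := h x hx y hy
  rw [edist_nndist, ENNReal.coe_lt_coe, ← NNReal.coe_lt_coe, coe_nndist] at this
  exact this

/-- The arc is the continuous image of `[0, s₀]`, where `s₀` is the first angle reaching `b`, or of
a full turn when `b` is never reached. -/
theorem isCompact_anticlockwiseArc (x a b : ℂ) : IsCompact (anticlockwiseArc x a b) := by
  set c : ℝ → ℂ := fun s => x + (a - x) * Complex.exp (s * Complex.I) with hc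
  have hcc : Continuous c := by fun_prop
  by_cases hb : ∃ s, 0 ≤ s ∧ c s = b
  · have hcl : IsClosed {s | 0 ≤ s ∧ c s = b} :=
      isClosed_Ici.inter (isClosed_eq hcc continuous_const)
    have hbdd : BddBelow {s | 0 ≤ s ∧ c s = b} := ⟨0, fun s hs => hs.1⟩
    have hm := hcl.csInf_mem hb hbdd
    set s₀ := sInf {s | 0 ≤ s ∧ c s = b} with hs₀
    have : anticlockwiseArc x a b = c '' Set.Icc 0 s₀ := by
      ext z
      constructor
      · rintro ⟨s, hs, rfl, hs'⟩
        refine ⟨s, ⟨hs, ?_⟩, rfl⟩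
        by_contra! hlt
        exact hs' s₀ hm.1 hlt hm.2
      · rintro ⟨s, ⟨hs, hs'⟩, rfl⟩
        refine ⟨s, hs, rfl, fun u hu hus he => ?_⟩
        have : s₀ ≤ u := csInf_le hbdd ⟨hu, he⟩
        linarith
    rw [this]
    exact isCompact_Icc.image hcc
  · push Not at hb
    have hper : Function.Periodic c (2 * Real.pi) := by
      intro s
      simp only [hc]
      push_cast
      rw [add_mul, Complex.exp_add, Complex.exp_two_pi_mul_I, mul_one]
    have : anticlockwiseArc x a b = c '' Set.Icc 0 (2 * Real.pi) := by
      ext z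
      constructor
      · rintro ⟨s, hs, rfl, -⟩
        obtain ⟨y, hy, he⟩ := hper.exists_mem_Ico₀ Real.two_pi_pos s
        exact ⟨y, ⟨hy.1, hy.2.le⟩, he.symm⟩
      · rintro ⟨s, ⟨hs, -⟩, rfl⟩
        exact ⟨s, hs, rfl, fun u hu _ => hb u hu⟩
    rw [this]
    exact isCompact_Icc.image hcc

theorem dist_of_mem_anticlockwiseArc {x a b z : ℂ} (hz : z ∈ anticlockwiseArc x a b) :
    dist z x = dist a x := by
  obtain ⟨s, -, rfl, -⟩ := hz
  simp [dist_eq_norm, Complex.norm_exp_ofReal_mul_I]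

theorem isCompact_sideCurve (γ : SimplePath) (σ : ℝ) : IsCompact (sideCurve γ σ) :=
  (isCompact_Icc.image γ.continuous_ext).union (isCompact_anticlockwiseArc _ _ _)

theorem sideRadius_pos {σ : ℝ} (hσ : σ ∈ Set.Ioo 0 γ.dur) : 0 < sideRadius γ σ := by
  have hmem : σ ∈ Set.Icc 0 γ.dur := ⟨hσ.1.le, hσ.2.le⟩
  refine lt_min (dist_pos.2 fun h => ?_) (dist_pos.2 fun h => ?_)
  · exact hσ.1.ne' (γ.ext_injOn hmem (Set.left_mem_Icc.2 γ.dur_nonneg) h)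
  · exact hσ.2.ne (γ.ext_injOn hmem (Set.right_mem_Icc.2 γ.dur_nonneg) h)

/-- The infimum is attained: `σ` itself is not on the circle, so `σ < s` may be replaced by the
closed condition `σ ≤ s`. The closing arc therefore stays at distance `sideRadius γ σ` from `x`. -/
theorem dist_firstExit {σ : ℝ} (hσ : σ ∈ Set.Ioo 0 γ.dur) :
    dist (γ.ext (firstExit γ σ)) (γ.ext σ) = sideRadius γ σ := by
  have hr := sideRadius_pos hσ
  have hd : Continuous fun s => dist (γ.ext s) (γ.ext σ) := γ.continuous_ext.dist continuous_const
  set S := {s : ℝ | s ∈ Set.Icc 0 γ.dur ∧ σ < s ∧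
    γ.ext s ∈ Metric.sphere (γ.ext σ) (sideRadius γ σ)} with hS
  have hS' : S = Set.Icc 0 γ.dur ∩
      (Set.Ici σ ∩ {s | dist (γ.ext s) (γ.ext σ) = sideRadius γ σ}) := by
    ext s
    refine and_congr_right fun _ => ⟨fun h => ⟨h.1.le, h.2⟩, fun h => ⟨lt_of_le_of_ne h.1 ?_, h.2⟩⟩
    rintro rfl
    have h2 := h.2
    simp only [Set.mem_ofPred_eq, dist_self] at h2
    exact hr.ne h2
  have hcl : IsClosed S := by
    rw [hS']
    exact isClosed_Icc.inter (isClosed_Ici.inter (isClosed_eq hd continuous_const))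
  have hne : S.Nonempty := by
    have hi := intermediate_value_Icc hσ.2.le hd.continuousOn
    obtain ⟨s, hs, hs'⟩ := hi ⟨by simpa using hr.le, by
      rw [dist_comm]
      exact min_le_right _ _⟩
    rw [hS']
    exact ⟨s, ⟨hσ.1.le.trans hs.1, hs.2⟩, hs.1, hs'⟩
  exact (hcl.csInf_mem hne ⟨0, fun s hs => hs.1.1⟩).2.2

/-! ### Stability of regular loops -/

/-- A parametrised perturbation of a simple path extends to a perturbation of the identity. -/
theorem SimplePath.exists_extension (γ γ' : SimplePath)
    (φ : Set.Icc (0 : ℝ) γ.dur ≃o Set.Icc (0 : ℝ) γ'.dur) {δ : ℝ}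
    (hδ : ∀ t, dist (γ.toFun t) (γ'.toFun (φ t)) ≤ δ) :
    ∃ f : ℂ → ℂ, Continuous f ∧ (∀ z, ‖f z - z‖ ≤ δ) ∧
      ∀ s, f (γ.toFun s) = γ'.toFun (φ s) := by
  have hemb : Topology.IsEmbedding γ.toFun :=
    (γ.continuous_toFun.isClosedEmbedding γ.injective_toFun).isEmbedding
  set e := hemb.toHomeomorph with he
  have : CompactSpace γ.range := isCompact_iff_compactSpace.1 γ.isCompact_range
  let D : C(γ.range, ℂ) := ⟨fun z => γ'.toFun (φ (e.symm z)) - z,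
    (γ'.continuous_toFun.comp (φ.continuous.comp e.symm.continuous)).sub continuous_subtype_val⟩
  have hes : ∀ s, e s = (⟨γ.toFun s, ⟨s, rfl⟩⟩ : γ.range) := fun s => rfl
  have hDs : ∀ s, D ⟨γ.toFun s, ⟨s, rfl⟩⟩ = γ'.toFun (φ s) - γ.toFun s := by
    intro s
    change γ'.toFun (φ (e.symm (e s))) - γ.toFun s = _
    rw [e.symm_apply_apply]
  have hδ0 : 0 ≤ δ := dist_nonneg.trans (hδ ⟨0, Set.left_mem_Icc.2 γ.dur_nonneg⟩)
  obtain ⟨g, hg, hgr⟩ := BoundedContinuousFunction.exists_norm_eq_domRestrict_eq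
    γ.isCompact_range.isClosed ℂ (BoundedContinuousFunction.mkOfCompact D)
  have hgn : ‖g‖ ≤ δ := by
    rw [hg, BoundedContinuousFunction.norm_le hδ0]
    rintro ⟨z, ⟨s, rfl⟩⟩
    change ‖D _‖ ≤ δ
    rw [hDs, ← dist_eq_norm, dist_comm]
    exact hδ s
  refine ⟨fun z => z + g z, continuous_id.add g.continuous, fun z => ?_, fun s => ?_⟩
  · simpa using (g.norm_coe_le_norm z).trans hgn
  · have h1 : g (γ.toFun s) = D ⟨γ.toFun s, ⟨s, rfl⟩⟩ :=
      DFunLike.congr_fun hgr ⟨γ.toFun s, ⟨s, rfl⟩⟩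
    change γ.toFun s + g (γ.toFun s) = _
    rw [h1, hDs]
    ring

/-- A perturbation of a loop crosses every perturbation of a path for which it is regular. -/
theorem IsRegular.exists_crossing (h : IsRegular γ ℓ) {η : ℝ} (hη : 0 < η) :
    ∃ δ : ℝ, 0 < δ ∧ ∀ (γ' : SimplePath) (φ : Set.Icc (0 : ℝ) γ.dur ≃o Set.Icc (0 : ℝ) γ'.dur)
      (ℓ' : Loop), (∀ t, dist (γ.toFun t) (γ'.toFun (φ t)) ≤ δ) →
      (∀ t : ℝ, dist (ℓ.ext t) (ℓ'.ext t) ≤ δ) →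
      ∃ s : Set.Icc (0 : ℝ) γ.dur, |(s : ℝ) - firstHit γ ℓ| < η ∧ γ'.toFun (φ s) ∈ ℓ'.range := by
  obtain ⟨hσm, -⟩ := firstHit_spec h.meets
  obtain ⟨θ, hθ, hbil⟩ := h.bilateral
  have hθm : θ ∈ roots γ ℓ := by rw [hθ]; rfl
  have hσ : firstHit γ ℓ ∈ Set.Ioo 0 γ.dur :=
    ⟨lt_of_le_of_ne hσm.1 h.firstHit_ne_zero.symm, lt_of_le_of_ne hσm.2 h.firstHit_ne_dur⟩
  set σ := firstHit γ ℓ with hσdef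
  obtain ⟨κ₀, hκ₀, hnear⟩ := exists_forall_dist_lt_imp γ.continuous_ext (a := 0) (b := γ.dur)
    (θ := σ) (fun t ht he => γ.ext_injOn ht hσm he) hη
  have hr := sideRadius_pos hσ
  -- `κ₀` localises the crossing in the parameter of `γ`; the bound by the side radius keeps it off
  -- the closing arc.
  set κ := min κ₀ (sideRadius γ σ) with hκ
  have hκ0 : 0 < κ := lt_min hκ₀ hr
  obtain ⟨ε, hε, hcont⟩ := Metric.continuous_iff.1 ℓ.continuous_ext θ (κ / 2) (half_pos hκ0)
  obtain ⟨⟨u, ⟨hu, -⟩, huL⟩, ⟨v, ⟨hv, -⟩, hvR⟩⟩ := hbil (ε / 2) (half_pos hε)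
  have hKc := isCompact_sideCurve γ σ
  set K := sideCurve γ σ with hK
  obtain ⟨ρ₁, hρ₁, hρ₁'⟩ := exists_forall_lt_dist hKc (isClosed_singleton (x := ℓ.ext u))
    (Set.disjoint_singleton_right.2 huL.1)
  obtain ⟨ρ₂, hρ₂, hρ₂'⟩ := exists_forall_lt_dist hKc (isClosed_singleton (x := ℓ.ext v))
    (Set.disjoint_singleton_right.2 hvR.1)
  refine ⟨min (κ / 4) (min (ρ₁ / 2) (ρ₂ / 2)), by positivity, fun γ' φ ℓ' hγ hℓ => ?_⟩
  set δ := min (κ / 4) (min (ρ₁ / 2) (ρ₂ / 2)) with hδ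
  have hδ1 : δ ≤ κ / 4 := min_le_left _ _
  have hδ2 : δ ≤ ρ₁ / 2 := (min_le_right _ _).trans (min_le_left _ _)
  have hδ3 : δ ≤ ρ₂ / 2 := (min_le_right _ _).trans (min_le_right _ _)
  obtain ⟨f, hf, hfn, hfs⟩ := γ.exists_extension γ' φ hγ
  have hℓn : ∀ t, ‖ℓ'.ext t - ℓ.ext t‖ ≤ δ := fun t => by
    rw [← dist_eq_norm, dist_comm]
    exact hℓ t
  obtain ⟨z, hz, w, hw, hfw⟩ := exists_mem_image_of_separated hKc huL.1 huL.2 hvR.2 hf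
    ℓ'.continuous_ext u v
    (fun z hz => by
      have := hρ₁' z hz _ rfl
      rw [dist_eq_norm] at this
      linarith [hfn z, hℓn u])
    (fun z hz => by
      have := hρ₂' z hz _ rfl
      rw [dist_eq_norm] at this
      linarith [hfn z, hℓn v])
  have hwθ : dist w θ < ε := by
    have hw' : w ∈ Set.Icc (θ - ε / 2) (θ + ε / 2) := Set.uIcc_subset_Icc hu hv hw
    rw [Real.dist_eq, abs_lt]
    constructor <;> linarith [hw'.1, hw'.2]
  have hzx : dist z (γ.ext σ) < κ := by
    have h1 := hcont w hwθ
    rw [hθm.2] at h1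
    have h2 : dist z (f z) ≤ δ := by
      rw [dist_comm, dist_eq_norm]
      exact hfn z
    have h3 := dist_triangle4 z (f z) (ℓ.ext w) (γ.ext σ)
    have h4 : dist (f z) (ℓ.ext w) ≤ δ := by
      rw [hfw, dist_comm]
      exact hℓ w
    linarith
  have hzγ : z ∈ γ.range := by
    rcases hz with ⟨s, -, rfl⟩ | hz
    · exact γ.ext_mem_range s
    · rw [dist_of_mem_anticlockwiseArc hz, dist_firstExit hσ] at hzx
      exact absurd hzx (not_lt.2 (min_le_right _ _))
  obtain ⟨s, rfl⟩ := hzγ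
  refine ⟨s, hnear s s.2 ?_, ?_⟩
  · rw [γ.ext_coe]
    exact hzx.trans_le (min_le_left _ _)
  · rw [← hfs, hfw]
    exact ℓ'.ext_mem_range w

/-- The piece of `γ` up to `σ - η` is compact and misses the loop, so it does so with a margin. This
lower bound requires no regularity. -/
theorem exists_forall_firstHit_sub_lt (hℓ : Meets γ ℓ) {η : ℝ} (hη : 0 < η) :
    ∃ δ : ℝ, 0 < δ ∧ ∀ (γ' : SimplePath) (φ : Set.Icc (0 : ℝ) γ.dur ≃o Set.Icc (0 : ℝ) γ'.dur)
      (ℓ' : Loop), (∀ t, dist (γ.toFun t) (γ'.toFun (φ t)) ≤ δ) →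
      (∀ t : ℝ, dist (ℓ.ext t) (ℓ'.ext t) ≤ δ) →
      ∀ s : Set.Icc (0 : ℝ) γ.dur, γ'.toFun (φ s) ∈ ℓ'.range → firstHit γ ℓ - η < s := by
  have hσ := firstHit_spec hℓ
  have hc : IsCompact (γ.ext '' Set.Icc 0 (firstHit γ ℓ - η)) :=
    isCompact_Icc.image γ.continuous_ext
  have hd : Disjoint (γ.ext '' Set.Icc 0 (firstHit γ ℓ - η)) ℓ.range := by
    rw [Set.disjoint_left]
    rintro _ ⟨s, hs, rfl⟩ hs'
    have := firstHit_le (γ := γ) (ℓ := ℓ) ⟨hs.1, by linarith [hs.2, hσ.1.2]⟩ hs'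
    linarith [hs.2]
  obtain ⟨ρ, hρ, h⟩ := exists_forall_lt_dist hc ℓ.isCompact_range.isClosed hd
  refine ⟨ρ / 2, half_pos hρ, fun γ' φ ℓ' hγ hℓ s hs => ?_⟩
  by_contra! hcon
  obtain ⟨t, -, ht⟩ := ℓ'.exists_ext_eq hs
  have h1 := h (γ.ext s) ⟨s, ⟨s.2.1, hcon⟩, rfl⟩ (ℓ.ext t) (ℓ.ext_mem_range t)
  have h2 := dist_triangle (γ.ext s) (γ'.toFun (φ s)) (ℓ.ext t)
  have h3 := hγ s
  rw [← γ.ext_coe] at h3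
  have h4 := hℓ t
  rw [ht, dist_comm] at h4
  linarith

/-- The first hitting time and the temporal roots of a regular loop are stable. -/
theorem IsRegular.stable (h : IsRegular γ ℓ) {θ : ℝ} (hθ : θ ∈ roots γ ℓ) {η : ℝ} (hη : 0 < η) :
    ∃ δ : ℝ, 0 < δ ∧ ∀ (γ' : SimplePath) (φ : Set.Icc (0 : ℝ) γ.dur ≃o Set.Icc (0 : ℝ) γ'.dur)
      (ℓ' : Loop), (∀ t, dist (γ.toFun t) (γ'.toFun (φ t)) ≤ δ) → (∀ t, |(φ t : ℝ) - t| ≤ δ) →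
      |ℓ.dur - ℓ'.dur| ≤ δ → (∀ t : ℝ, dist (ℓ.ext t) (ℓ'.ext t) ≤ δ) →
      Meets γ' ℓ' ∧ |firstHit γ' ℓ' - firstHit γ ℓ| ≤ η ∧ ∀ θ' ∈ roots γ' ℓ', |θ' - θ| ≤ η := by
  obtain ⟨θ₁, hθ₁, -⟩ := h.bilateral
  have hu : ∀ t ∈ Set.Icc 0 ℓ.dur, ℓ.ext t = ℓ.ext θ → t = θ := by
    intro t ht he
    have h1 : t ∈ roots γ ℓ := ⟨ht, he.trans hθ.2⟩
    rw [hθ₁] at hθ h1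
    exact h1.trans hθ.symm
  obtain ⟨ρ, hρ, hroot⟩ := exists_forall_dist_lt_imp ℓ.continuous_ext hu (half_pos hη)
  obtain ⟨τ, hτ, hcont⟩ := Metric.continuous_iff.1 γ.continuous_ext (firstHit γ ℓ) (ρ / 2)
    (half_pos hρ)
  set η' := min (η / 2) (τ / 2) with hη'
  have hη'0 : 0 < η' := by positivity
  have hη'1 : η' ≤ η / 2 := min_le_left _ _
  have hη'2 : η' ≤ τ / 2 := min_le_right _ _
  obtain ⟨δ₁, hδ₁, hcross⟩ := h.exists_crossing hη'0
  obtain ⟨δ₂, hδ₂, hlow⟩ := exists_forall_firstHit_sub_lt h.meets hη'0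
  set δ := min (min δ₁ δ₂) (min (η' / 2) (ρ / 8)) with hδ
  have hd1 : δ ≤ δ₁ := (min_le_left _ _).trans (min_le_left _ _)
  have hd2 : δ ≤ δ₂ := (min_le_left _ _).trans (min_le_right _ _)
  have hd3 : δ ≤ η' / 2 := (min_le_right _ _).trans (min_le_left _ _)
  have hd4 : δ ≤ ρ / 8 := (min_le_right _ _).trans (min_le_right _ _)
  refine ⟨δ, by positivity, fun γ' φ ℓ' hγ hφ hdur hℓ => ?_⟩
  obtain ⟨s, hs, hsm⟩ := hcross γ' φ ℓ' (fun t => (hγ t).trans hd1) (fun t => (hℓ t).trans hd1)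
  have hmeets : Meets γ' ℓ' := ⟨_, hsm, ⟨φ s, rfl⟩⟩
  obtain ⟨hσ'm, hσ'r⟩ := firstHit_spec hmeets
  obtain ⟨s', hs'⟩ : ∃ s', φ s' = ⟨firstHit γ' ℓ', hσ'm⟩ := φ.surjective _
  have hs'r : γ'.toFun (φ s') ∈ ℓ'.range := by
    rw [hs', ← γ'.ext_of_mem]
    exact hσ'r
  have hlow' := hlow γ' φ ℓ' (fun t => (hγ t).trans hd2) (fun t => (hℓ t).trans hd2) s' hs'r
  have hle : firstHit γ' ℓ' ≤ φ s := firstHit_le (φ s).2 (by rw [γ'.ext_coe]; exact hsm)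
  -- The crossing at `s` bounds the first hit from above, and `hlow'` bounds it from below;
  -- monotonicity of `φ` transfers both to `s'`.
  have hle' : s' ≤ s := φ.le_iff_le.1 (by rw [hs']; exact hle)
  have hle'' : (s' : ℝ) ≤ s := hle'
  have hs'1 := abs_le.1 (hφ s')
  have hs2 := abs_lt.1 hs
  have hφs' : (φ s' : ℝ) = firstHit γ' ℓ' := by rw [hs']
  refine ⟨hmeets, ?_, fun θ' hθ' => ?_⟩
  · rw [abs_le]
    constructor <;> linarith
  · have h1 : dist (γ.ext s') (γ.ext (firstHit γ ℓ)) < ρ / 2 := by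
      apply hcont
      rw [Real.dist_eq, abs_lt]
      constructor <;> linarith
    have h2 : ℓ'.ext θ' = γ'.toFun (φ s') := by
      rw [hθ'.2, ← hφs', γ'.ext_coe]
    have h3 := hγ s'
    rw [← γ.ext_coe, ← h2, dist_comm] at h3
    have h4 := hℓ θ'
    have hd := abs_le.1 hdur
    -- The root `θ'` may exceed the duration of `ℓ`. Clamping moves it by at most `δ` and does not
    -- change the value of `ℓ.ext`.
    set t : ℝ := ((Set.projIcc 0 ℓ.dur ℓ.dur_nonneg θ' : Set.Icc (0 : ℝ) ℓ.dur) : ℝ) with ht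
    have htm : t ∈ Set.Icc 0 ℓ.dur := (Set.projIcc 0 ℓ.dur ℓ.dur_nonneg θ').2
    have ht' : |t - θ'| ≤ δ := by
      rw [ht, Set.coe_projIcc, max_eq_right (le_min ℓ.dur_nonneg hθ'.1.1)]
      rcases min_cases ℓ.dur θ' with ⟨h, h'⟩ | ⟨h, h'⟩ <;> rw [h, abs_le]
      · constructor <;> linarith [hθ'.1.2]
      · constructor <;> linarith
    have h5 : dist (ℓ.ext t) (ℓ.ext θ) < ρ := by
      rw [ht, ← ℓ.ext_eq_ext_projIcc, hθ.2]
      have := dist_triangle4 (ℓ.ext θ') (ℓ'.ext θ') (γ.ext s') (γ.ext (firstHit γ ℓ))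
      linarith
    have h6 := abs_lt.1 (hroot t htm h5)
    have h7 := abs_le.1 ht'
    rw [abs_le]
    constructor <;> linarith

/-- A loop of duration zero has a single value, which cannot lie on both sides. -/
theorem IsRegular.dur_pos (h : IsRegular γ ℓ) : 0 < ℓ.dur := by
  refine lt_of_le_of_ne ℓ.dur_nonneg fun h0 => ?_
  obtain ⟨θ, -, hb⟩ := h.bilateral
  have hmem : ∀ t ∈ Set.Icc 0 ℓ.dur, t = 0 := fun t ht => le_antisymm (ht.2.trans h0.ge) ht.1
  obtain ⟨⟨u, ⟨-, hu⟩, huL⟩, ⟨v, ⟨-, hv⟩, hvR⟩⟩ := hb 1 one_pos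
  rw [hmem u hu] at huL
  rw [hmem v hv] at hvR
  exact hvR.2 huL.2

/-- Values of members of a family at parameters at distance at most `κ` are at distance at most
`e`. -/
def LoopFamily.Equi (L : LoopFamily) (κ e : ℝ) : Prop :=
  ∀ a : L.Elem, ∀ u v : ℝ, |u - v| ≤ κ → dist (a.1.ext u) (a.1.ext v) ≤ e

theorem LoopFamily.equi_of_modulus_le {L : LoopFamily} {κ e : ℝ} (he : 0 ≤ e)
    (h : L.modulus κ ≤ ENNReal.ofReal e) : L.Equi κ e := by
  intro a u v huv
  rw [a.1.ext_eq_ext_projIcc u, a.1.ext_eq_ext_projIcc v, a.1.ext_coe, a.1.ext_coe,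
    ← edist_le_ofReal he]
  refine le_trans ?_ h
  refine le_trans ?_ (le_iSup (fun a : L.Elem => a.1.toTimedFun.modulus κ) a)
  refine le_iSup₂_of_le (Set.projIcc 0 a.1.dur a.1.dur_nonneg u)
    (Set.projIcc 0 a.1.dur a.1.dur_nonneg v) ?_
  exact le_iSup_of_le ((Set.abs_projIcc_sub_projIcc _).trans huv) le_rfl

/-! ### The order of visits and compatible positions on the path -/

namespace PathLoops

open TieBreak

variable {X : PathLoops} {lam : ℝ} {B : TieBreak X}

theorem Hit.time_mem (e : X.Hit) : e.time ∈ Set.Icc 0 X.path.dur := (firstHit_spec e.2).1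

theorem MemR'.memR0 (h : X.MemR' lam) : X.MemR0 := by
  rcases h with ⟨h, -⟩ | ⟨h, -⟩
  · exact h.toMemR0
  · exact h

theorem prec_trichotomy (B : TieBreak X) (e e' : X.Hit) :
    B.prec e e' ∨ e = e' ∨ B.prec e' e := by
  rcases lt_trichotomy e.time e'.time with h | h | h
  · exact Or.inl (Or.inl h)
  · have := B.isStrictTotalOrder e'.time
    rcases trichotomous_of (B.before e'.time) ⟨e, h⟩ ⟨e', rfl⟩ with k | k | k
    · exact Or.inl (Or.inr ⟨h, k⟩)
    · exact Or.inr (Or.inl (congrArg Subtype.val k))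
    · refine Or.inr (Or.inr (Or.inr ⟨h.symm, ?_⟩))
      -- The order `B.before` is indexed by the hitting time, so it must be transported along an
      -- equality of times.
      have gen : ∀ (σ : ℝ) (hσ : e'.time = σ) (h1 : e.time = e'.time) (h2 : e.time = σ),
          B.before e'.time ⟨e', rfl⟩ ⟨e, h1⟩ → B.before σ ⟨e', hσ⟩ ⟨e, h2⟩ := by
        rintro σ rfl h1 h2 k
        exact k
      exact gen _ h.symm h rfl k
  · exact Or.inr (Or.inr (Or.inl h))

theorem prec_irrefl (B : TieBreak X) (e : X.Hit) : ¬ B.prec e e := by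
  rintro (h | ⟨_, h⟩)
  · exact lt_irrefl _ h
  · have := B.isStrictTotalOrder e.time
    exact irrefl_of (B.before e.time) _ h

theorem prec_trans {e₁ e₂ e₃ : X.Hit} (h : B.prec e₁ e₂) (h' : B.prec e₂ e₃) :
    B.prec e₁ e₃ := by
  rcases h with h | ⟨h, k⟩ <;> rcases h' with h' | ⟨h', k'⟩
  · exact Or.inl (h.trans h')
  · exact Or.inl (h.trans_eq h')
  · exact Or.inl (h.trans_lt h')
  · refine Or.inr ⟨h.trans h', ?_⟩
    have := B.isStrictTotalOrder e₃.time
    have gen : ∀ (σ : ℝ) (hσ : e₂.time = σ) (h1 : e₁.time = e₂.time) (h2 : e₁.time = σ),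
        B.before e₂.time ⟨e₁, h1⟩ ⟨e₂, rfl⟩ → B.before σ ⟨e₁, h2⟩ ⟨e₂, hσ⟩ := by
      rintro σ rfl h1 h2 k
      exact k
    exact trans_of (B.before e₃.time) (gen _ h' h (h.trans h') k) k'

theorem prec_time_le {e e' : X.Hit} (h : B.prec e e') : e.time ≤ e'.time := by
  rcases h with h | ⟨h, -⟩
  · exact h.le
  · exact h.le

/-- Comparison of a sum over a set with the sum over its intersection with a finite set. -/
theorem sum_filter_le_tsum_subtype {ι : Type*} {d : ι → ℝ} (hd : Summable d) (h0 : ∀ i, 0 ≤ d i)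
    (F : Finset ι) (p : ι → Prop) [DecidablePred p] :
    ∑ i ∈ F with p i, d i ≤ ∑' i : {i // p i}, d i := by
  rw [show (∑' i : {i // p i}, d i) = ∑' i, Set.indicator {i | p i} d i from tsum_subtype _ d]
  have h1 : ∑ i ∈ F with p i, d i = ∑ i ∈ F, Set.indicator {i | p i} d i := by
    rw [Finset.sum_filter]
    exact Finset.sum_congr rfl fun i _ => by simp [Set.indicator]
  rw [h1]
  exact (hd.indicator _).sum_le_tsum F fun i _ => Set.indicator_nonneg (fun i _ => h0 i) i

/-- The mass of `p` outside `F` is at most the whole mass outside `F`. -/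
theorem tsum_subtype_le_sum_filter_add {ι : Type*} {d : ι → ℝ} (hd : Summable d)
    (h0 : ∀ i, 0 ≤ d i) (F : Finset ι) (p : ι → Prop) [DecidablePred p] :
    ∑' i : {i // p i}, d i ≤ ∑ i ∈ F with p i, d i + (∑' i, d i - ∑ i ∈ F, d i) := by
  have h1 := sum_filter_le_tsum_subtype hd h0 F fun i => ¬ p i
  have h2 : ∑' i : {i // p i}, d i + ∑' i : {i // ¬ p i}, d i = ∑' i, d i :=
    hd.tsum_subtype_add_tsum_subtype_compl {i | p i}
  have h3 := Finset.sum_filter_add_sum_filter_not F p d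
  linarith

theorem tsum_subtype_mono {ι : Type*} {d : ι → ℝ} (hd : Summable d) (h0 : ∀ i, 0 ≤ d i)
    {p q : ι → Prop} (hpq : ∀ i, p i → q i) : ∑' i : {i // p i}, d i ≤ ∑' i : {i // q i}, d i := by
  rw [show (∑' i : {i // p i}, d i) = ∑' i, Set.indicator {i | p i} d i from tsum_subtype _ d,
    show (∑' i : {i // q i}, d i) = ∑' i, Set.indicator {i | q i} d i from tsum_subtype _ d]
  exact Summable.tsum_le_tsum
    (fun i => Set.indicator_le_indicator_of_subset (fun i hi => hpq i hi) h0 i)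
    (hd.indicator _) (hd.indicator _)

theorem tsum_subtype_or_eq {ι : Type*} {d : ι → ℝ} (hd : Summable d) {p : ι → Prop} {e : ι}
    (he : ¬ p e) : ∑' i : {i // p i ∨ i = e}, d i = ∑' i : {i // p i}, d i + d e := by
  have h := (hd.subtype {i | p i}).tsum_union_disjoint (t := {e})
    (Set.disjoint_singleton_right.2 he) (hd.subtype _)
  rw [tsum_singleton] at h
  exact h

theorem finish_le_start (hX : X.MemR0) (hlam : 0 ≤ lam) {e e' : X.Hit} (h : B.prec e e') :
    B.finish lam e ≤ B.start lam e' := by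
  have h1 : ∑' i : {i : X.Hit // B.prec i e}, i.1.loop.dur + e.loop.dur ≤
      ∑' i : {i : X.Hit // B.prec i e'}, i.1.loop.dur := by
    rw [← tsum_subtype_or_eq hX.summable_dur (p := fun i => B.prec i e) (prec_irrefl B e)]
    refine tsum_subtype_mono hX.summable_dur (fun i => i.loop.dur_nonneg) ?_
    rintro i (hi | rfl)
    · exact prec_trans hi h
    · exact h
  have h2 := mul_le_mul_of_nonneg_left (prec_time_le h) hlam
  unfold finish start
  linarith

theorem start_le_finish (e : X.Hit) : B.start lam e ≤ B.finish lam e :=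
  le_add_of_nonneg_right e.loop.dur_nonneg

/-- An inversion would force the later loop to end no earlier than it should, leaving only zero
duration and equal starts. For `λ = 0` regularity excludes zero durations; for `λ > 0` the term `λ
σ` separates the starts. -/
theorem time_le_of_finish_le_start (hX : X.MemR' lam) {t : ℝ} {e e' : X.Hit}
    (he : B.finish lam e ≤ t) (he' : t ≤ B.start lam e') : e.time ≤ e'.time := by
  rcases prec_trichotomy B e e' with h | h | h
  · exact prec_time_le h
  · rw [h]
  · have h1 := finish_le_start hX.memR0 hX.nonneg h
    have h2 := start_le_finish (B := B) (lam := lam) e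
    have h3 := start_le_finish (B := B) (lam := lam) e'
    have h4 : B.start lam e' = B.finish lam e' := by linarith
    rcases hX with ⟨hX, -⟩ | ⟨hX, hlam⟩
    · have := (hX.regular e').dur_pos
      unfold finish at h4
      exact absurd h4 (by
        have : 0 < e'.loop.dur := this
        linarith)
    · by_contra! hlt
      have hlt' := mul_lt_mul_of_pos_left hlt hlam
      have h5 : ∑' i : {i : X.Hit // B.prec i e'}, i.1.loop.dur ≤
          ∑' i : {i : X.Hit // B.prec i e}, i.1.loop.dur :=
        tsum_subtype_mono hX.summable_dur (fun i => i.loop.dur_nonneg) fun i hi => prec_trans hi h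
      have h6 : B.start lam e' < B.start lam e := by
        unfold start
        linarith
      linarith

theorem eq_of_mem_Ioo (hX : X.MemR0) (hlam : 0 ≤ lam) {t : ℝ} {e e' : X.Hit}
    (he : t ∈ Set.Ioo (B.start lam e) (B.finish lam e))
    (he' : t ∈ Set.Ioo (B.start lam e') (B.finish lam e')) : e = e' := by
  rcases prec_trichotomy B e e' with h | h | h
  · have := finish_le_start hX hlam h
    linarith [he.2, he'.1]
  · exact h
  · have := finish_le_start hX hlam h
    linarith [he.1, he'.2]

theorem attachAt_of_mem_Ioo (hX : X.MemR0) (hlam : 0 ≤ lam) {t : ℝ} {e : X.Hit}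
    (he : t ∈ Set.Ioo (B.start lam e) (B.finish lam e)) :
    X.attachAt lam B t = B.rerooted e (t - B.start lam e) := by
  have h : ∃ e : X.Hit, t ∈ Set.Ioo (B.start lam e) (B.finish lam e) := ⟨e, he⟩
  rw [attachAt, dif_pos h, eq_of_mem_Ioo hX hlam h.choose_spec he]

theorem mu_mem {t : ℝ} (ht : t ∈ Set.Icc 0 (X.totalTime lam)) :
    B.mu lam t ∈ Set.Icc 0 1 := by
  have h1 : B.tMinus lam t ≤ t := by
    refine csSup_le (Set.insert_nonempty _ _) ?_
    rintro u (rfl | ⟨e, he, rfl⟩)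
    · exact ht.1
    · exact he
  have h2 : t ≤ B.tPlus lam t := by
    refine le_csInf (Set.insert_nonempty _ _) ?_
    rintro u (rfl | ⟨e, he, rfl⟩)
    · exact ht.2
    · exact he
  unfold mu
  split_ifs with h
  · exact ⟨le_rfl, zero_le_one⟩
  · have h3 : 0 < B.tPlus lam t - B.tMinus lam t :=
      sub_pos.2 (lt_of_le_of_ne (h1.trans h2) h)
    exact ⟨div_nonneg (by linarith) h3.le, (div_le_one h3).2 (by linarith)⟩

theorem sigmaMinus_le_sigmaPlus (hX : X.MemR' lam) (t : ℝ) :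
    B.sigmaMinus lam t ≤ B.sigmaPlus lam t := by
  refine csSup_le (Set.insert_nonempty _ _) ?_
  rintro u hu
  refine le_csInf (Set.insert_nonempty _ _) ?_
  rintro v hv
  rcases hu with rfl | ⟨e, he, rfl⟩ <;> rcases hv with rfl | ⟨e', he', rfl⟩
  · exact X.path.dur_nonneg
  · exact e'.time_mem.1
  · exact e.time_mem.2
  · exact time_le_of_finish_le_start hX he he'

theorem bddAbove_sigmaMinus (t : ℝ) :
    BddAbove (insert 0 {u : ℝ | ∃ e : X.Hit, B.finish lam e ≤ t ∧ u = e.time}) := by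
  refine ⟨X.path.dur, ?_⟩
  rintro u (rfl | ⟨e, he, rfl⟩)
  · exact X.path.dur_nonneg
  · exact e.time_mem.2

theorem bddBelow_sigmaPlus (t : ℝ) :
    BddBelow (insert X.path.dur {u : ℝ | ∃ e : X.Hit, t ≤ B.start lam e ∧ u = e.time}) := by
  refine ⟨0, ?_⟩
  rintro u (rfl | ⟨e, he, rfl⟩)
  · exact X.path.dur_nonneg
  · exact e.time_mem.1

theorem sigma_mem (hX : X.MemR' lam) {t : ℝ} (ht : t ∈ Set.Icc 0 (X.totalTime lam)) :
    B.sigma lam t ∈ Set.Icc (B.sigmaMinus lam t) (B.sigmaPlus lam t) := by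
  have h1 := mu_mem (B := B) ht
  have h2 := sigmaMinus_le_sigmaPlus (B := B) hX t
  unfold sigma
  constructor
  · nlinarith [mul_nonneg h1.1 (sub_nonneg.2 h2)]
  · nlinarith [mul_nonneg (sub_nonneg.2 h1.2) (sub_nonneg.2 h2)]

/-- `s` is a position on the path which is compatible with the order of the loops at time `t`. -/
structure IsPosition (B : TieBreak X) (lam t s : ℝ) : Prop where
  mem : s ∈ Set.Icc 0 X.path.dur
  time_le : ∀ e : X.Hit, B.start lam e < t → e.time ≤ s
  le_time : ∀ e : X.Hit, t < B.finish lam e → s ≤ e.time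

theorem isPosition_time (hX : X.MemR0) (hlam : 0 ≤ lam) {t : ℝ} {e : X.Hit}
    (he : t ∈ Set.Ioo (B.start lam e) (B.finish lam e)) : IsPosition B lam t e.time := by
  refine ⟨e.time_mem, fun e' h' => ?_, fun e' h' => ?_⟩
  · rcases prec_trichotomy B e e' with h | h | h
    · have := finish_le_start hX hlam h
      linarith [he.2]
    · rw [h]
    · exact prec_time_le h
  · rcases prec_trichotomy B e e' with h | h | h
    · exact prec_time_le h
    · rw [h]
    · have := finish_le_start hX hlam h
      linarith [he.1]

/-- Outside all open visit intervals, a loop that has started is finished, and one that is not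
finished has not started. -/
theorem isPosition_sigma (hX : X.MemR' lam) {t : ℝ} (ht : t ∈ Set.Icc 0 (X.totalTime lam))
    (hn : ¬ ∃ e : X.Hit, t ∈ Set.Ioo (B.start lam e) (B.finish lam e)) :
    IsPosition B lam t (B.sigma lam t) := by
  have hs := sigma_mem (B := B) hX ht
  have h0 : 0 ≤ B.sigmaMinus lam t := le_csSup (bddAbove_sigmaMinus t) (Set.mem_insert _ _)
  have h1 : B.sigmaPlus lam t ≤ X.path.dur :=
    csInf_le (bddBelow_sigmaPlus t) (Set.mem_insert _ _)
  refine ⟨⟨h0.trans hs.1, hs.2.trans h1⟩, fun e he => ?_, fun e he => ?_⟩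
  · refine le_trans ?_ hs.1
    refine le_csSup (bddAbove_sigmaMinus t) (Or.inr ⟨e, ?_, rfl⟩)
    by_contra! hlt
    exact hn ⟨e, he, hlt⟩
  · refine hs.2.trans ?_
    refine csInf_le (bddBelow_sigmaPlus t) (Or.inr ⟨e, ?_, rfl⟩)
    by_contra! hlt
    exact hn ⟨e, hlt, he⟩

theorem root_spec (B : TieBreak X) (e : X.Hit) :
    B.root e ∈ Set.Icc 0 e.loop.dur ∧ e.loop.ext (B.root e) = X.path.ext e.time :=
  B.root_mem e

/-- Near its ends, a rerooted loop is close to its root. -/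
theorem dist_rerooted_le {κ w : ℝ} (hE : X.loops.Equi κ w) (e : X.Hit) {u : ℝ}
    (hu : u ∈ Set.Icc 0 e.loop.dur) (h : u ≤ κ ∨ e.loop.dur - κ ≤ u) :
    dist (B.rerooted e u) (X.path.ext e.time) ≤ 2 * w := by
  obtain ⟨hθ, hx⟩ := root_spec B e
  have hE' : ∀ u v : ℝ, |u - v| ≤ κ → dist (e.loop.ext u) (e.loop.ext v) ≤ w := hE e.1
  have hκ : 0 ≤ κ := by
    rcases h with h | h
    · exact hu.1.trans h
    · linarith [hu.2]
  have hw : 0 ≤ w := dist_nonneg.trans (hE' 0 0 (by simpa using hκ))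
  rw [← hx]
  unfold rerooted
  split_ifs with hc
  · rcases h with h | h
    · have := hE' (u + B.root e) (B.root e) (by rw [abs_le]; constructor <;> linarith [hu.1])
      linarith
    · have h1 := hE' (u + B.root e) e.loop.dur
        (by rw [abs_le]; constructor <;> linarith [hu.1, hθ.1])
      have h2 := hE' 0 (B.root e) (by rw [abs_le]; constructor <;> linarith [hu.1, hθ.1])
      rw [e.loop.ext_zero_eq] at h2
      linarith [dist_triangle (e.loop.ext (u + B.root e)) (e.loop.ext e.loop.dur)
        (e.loop.ext (B.root e))]
  · rw [not_le] at hc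
    rcases h with h | h
    · have h1 := hE' (u + B.root e - e.loop.dur) 0
        (by rw [abs_le]; constructor <;> linarith [hu.1, hθ.2])
      have h2 := hE' e.loop.dur (B.root e)
        (by rw [abs_le]; constructor <;> linarith [hu.1, hθ.2])
      rw [e.loop.ext_zero_eq] at h1
      linarith [dist_triangle (e.loop.ext (u + B.root e - e.loop.dur)) (e.loop.ext e.loop.dur)
        (e.loop.ext (B.root e))]
    · have := hE' (u + B.root e - e.loop.dur) (B.root e)
        (by rw [abs_le]; constructor <;> linarith [hu.1, hu.2])
      linarith

/-- At each time, the attached path is close to a compatible position on the path, or well inside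
a loop. -/
theorem exists_isPosition (hX : X.MemR' lam) {κ w : ℝ} (hE : X.loops.Equi κ w)
    (hw : 0 ≤ w) {t : ℝ} (ht : t ∈ Set.Icc 0 (X.totalTime lam)) :
    (∃ s, IsPosition B lam t s ∧ dist (X.attachAt lam B t) (X.path.ext s) ≤ 2 * w) ∨
      ∃ e : X.Hit, B.start lam e + κ < t ∧ t < B.finish lam e - κ := by
  by_cases hn : ∃ e : X.Hit, t ∈ Set.Ioo (B.start lam e) (B.finish lam e)
  · obtain ⟨e, he⟩ := hn
    by_cases hin : B.start lam e + κ < t ∧ t < B.finish lam e - κ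
    · exact Or.inr ⟨e, hin⟩
    · refine Or.inl ⟨e.time, isPosition_time hX.memR0 hX.nonneg he, ?_⟩
      rw [attachAt_of_mem_Ioo hX.memR0 hX.nonneg he]
      have hf : B.finish lam e = B.start lam e + e.loop.dur := rfl
      refine dist_rerooted_le hE e ⟨by linarith [he.1], by linarith [he.2]⟩ ?_
      by_contra! hcon
      exact hin ⟨by linarith [hcon.1], by linarith [hcon.2]⟩
  · refine Or.inl ⟨_, isPosition_sigma hX ht hn, ?_⟩
    rw [attachAt, dif_neg hn, dist_self]
    positivity

/-- Comparison of two rerooted loops. -/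
theorem dist_rerooted_rerooted_le {X' : PathLoops} {B' : TieBreak X'} {κ w η : ℝ}
    (hη : 4 * η ≤ κ) (hE : X.loops.Equi κ w) (e : X.Hit) (e' : X'.Hit)
    (hdur : |e.loop.dur - e'.loop.dur| ≤ η) (hroot : |B'.root e' - B.root e| ≤ η)
    (hd : ∀ t : ℝ, dist (e.loop.ext t) (e'.loop.ext t) ≤ η) {u u' : ℝ}
    (huu : |u - u'| ≤ 2 * η) :
    dist (B.rerooted e u) (B'.rerooted e' u') ≤ 2 * w + η := by
  obtain ⟨hθ, -⟩ := root_spec B e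
  obtain ⟨hθ', -⟩ := root_spec B' e'
  have hη0 : 0 ≤ η := (abs_nonneg _).trans hdur
  have hE' : ∀ u v : ℝ, |u - v| ≤ κ → dist (e.loop.ext u) (e.loop.ext v) ≤ w := hE e.1
  have hw : 0 ≤ w := dist_nonneg.trans (hE' 0 0 (by simp; linarith))
  have h1 := abs_le.1 hdur
  have h2 := abs_le.1 hroot
  have h3 := abs_le.1 huu
  have key : ∀ v v' : ℝ, |v - v'| ≤ κ →
      dist (e.loop.ext v) (e'.loop.ext v') ≤ 2 * w + η := fun v v' hv => by
    linarith [dist_triangle (e.loop.ext v) (e.loop.ext v') (e'.loop.ext v'), hE' v v' hv, hd v']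
  -- For the case where only one loop has wrapped: both arguments are within `κ` of opposite ends,
  -- which carry the same value. The budget `4 * η` is `2 * η` for the times and `η` each for roots
  -- and durations.
  have key' : ∀ v v' c c' : ℝ, e.loop.ext c = e.loop.ext c' → |v - c| ≤ κ → |c' - v'| ≤ κ →
      dist (e.loop.ext v) (e'.loop.ext v') ≤ 2 * w + η := fun v v' c c' hcc hv hv' => by
    have h4 := hE' v c hv
    have h5 := hE' c' v' hv'
    rw [← hcc] at h5
    linarith [dist_triangle4 (e.loop.ext v) (e.loop.ext c) (e.loop.ext v') (e'.loop.ext v'), hd v']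
  unfold rerooted
  split_ifs with ha hb hb
  · exact key _ _ (by rw [abs_le]; constructor <;> linarith)
  · rw [not_le] at hb
    exact key' _ _ _ _ e.loop.ext_zero_eq.symm (by rw [abs_le]; constructor <;> linarith)
      (by rw [abs_le]; constructor <;> linarith [hθ'.2])
  · rw [not_le] at ha
    exact key' _ _ _ _ e.loop.ext_zero_eq (by rw [abs_le]; constructor <;> linarith [hθ.2])
      (by rw [abs_le]; constructor <;> linarith)
  · exact key _ _ (by rw [abs_le]; constructor <;> linarith)

end PathLoops

/-! ### Matchings and comparison of two attached paths -/

namespace PathLoops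

open TieBreak

variable {X X' : PathLoops} {lam lam' : ℝ} {B : TieBreak X} {B' : TieBreak X'}

/-- A correspondence, with precision `α`, between the main loops which meet the first path and
the main loops which meet the second path. -/
structure Matching (B : TieBreak X) (B' : TieBreak X') (lam lam' α : ℝ) (F : Finset X.Hit) where
  map : F → X'.Hit
  dur_le : ∀ e ∉ F, e.loop.dur ≤ α
  dur_le' : ∀ e', (∀ e, map e ≠ e') → e'.loop.dur ≤ α
  time : ∀ e : F, |(map e).time - e.1.time| ≤ α
  root : ∀ e : F, |B'.root (map e) - B.root e.1| ≤ α
  dur : ∀ e : F, |e.1.loop.dur - (map e).loop.dur| ≤ α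
  ext : ∀ (e : F) (t : ℝ), dist (e.1.loop.ext t) ((map e).loop.ext t) ≤ α
  start : ∀ e : F, |B'.start lam' (map e) - B.start lam e.1| ≤ α

variable {α : ℝ} {F : Finset X.Hit}

/-- Matched loops are close at times when both are being visited. -/
theorem Matching.dist_attachAt_le_of_mem (M : Matching B B' lam lam' α F) (hX : X.MemR' lam)
    (hX' : X'.MemR' lam') {κ w : ℝ} (hκ : 4 * α ≤ κ) (hE : X.loops.Equi κ w) {t t' : ℝ}
    (htt : |t - t'| ≤ α) (e : F) (he : t ∈ Set.Ioo (B.start lam e.1) (B.finish lam e.1))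
    (he' : t' ∈ Set.Ioo (B'.start lam' (M.map e)) (B'.finish lam' (M.map e))) :
    dist (X.attachAt lam B t) (X'.attachAt lam' B' t') ≤ 2 * w + α := by
  rw [attachAt_of_mem_Ioo hX.memR0 hX.nonneg he, attachAt_of_mem_Ioo hX'.memR0 hX'.nonneg he']
  have h1 := abs_le.1 (M.start e)
  have h2 := abs_le.1 htt
  refine dist_rerooted_rerooted_le hκ hE e.1 (M.map e) (M.dur e) (M.root e) (M.ext e) ?_
  rw [abs_le]
  constructor <;> linarith

/-- Compatible positions at nearby times are close. -/
theorem Matching.abs_position_sub_le (M : Matching B B' lam lam' α F) {η : ℝ}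
    (hη : α ≤ η) (hdur : X'.path.dur ≤ X.path.dur + α)
    (hF : ∀ m ∈ Set.Icc 0 X.path.dur, ∃ e ∈ F, |e.time - m| < η ∧ 5 * α < e.loop.dur)
    {t t' s s' : ℝ} (htt : |t - t'| ≤ α) (hs : IsPosition B lam t s)
    (hs' : IsPosition B' lam' t' s') : |s - s'| ≤ 4 * η := by
  have h2 := abs_le.1 htt
  have hα : 0 ≤ α := (abs_nonneg _).trans htt
  rw [abs_le]
  constructor
  · by_contra! hcon
    -- A net loop near `s + 2 * η` is hit after `s`, and its partner before `s'`. So it starts no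
    -- earlier than `t` while its partner ends by `t'`, which forces its duration to be at most `3 *
    -- α`.
    obtain ⟨e, heF, hem, hed⟩ := hF (s + 2 * η)
      ⟨by linarith [hs.mem.1], by linarith [hs'.mem.2]⟩
    have h3 := abs_lt.1 hem
    have h4 := abs_le.1 (M.time ⟨e, heF⟩)
    have h5 := abs_le.1 (M.start ⟨e, heF⟩)
    have h6 := abs_le.1 (M.dur ⟨e, heF⟩)
    have h7 : t ≤ B.start lam e := by
      by_contra! h
      linarith [hs.time_le e h]
    have h8 : B'.finish lam' (M.map ⟨e, heF⟩) ≤ t' := by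
      by_contra! h
      linarith [hs'.le_time _ h]
    unfold finish at h8
    linarith
  · by_contra! hcon
    obtain ⟨e, heF, hem, hed⟩ := hF (s - 2 * η)
      ⟨by linarith [hs'.mem.1], by linarith [hs.mem.2]⟩
    have h3 := abs_lt.1 hem
    have h4 := abs_le.1 (M.time ⟨e, heF⟩)
    have h5 := abs_le.1 (M.start ⟨e, heF⟩)
    have h7 : t' ≤ B'.start lam' (M.map ⟨e, heF⟩) := by
      by_contra! h
      linarith [hs'.time_le _ h]
    have h8 : B.finish lam e ≤ t := by
      by_contra! h
      linarith [hs.le_time _ h]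
    unfold finish at h8
    linarith

/-- Attached paths with matched loops are uniformly close. -/
theorem Matching.dist_attachAt_le (M : Matching B B' lam lam' α F) (hX : X.MemR' lam)
    (hX' : X'.MemR' lam') {κ w η : ℝ} (hα : 0 < α) (hκ : 4 * α ≤ κ) (hw : 0 ≤ w) (hη : α ≤ η)
    (hE : X.loops.Equi κ w) (hE' : X'.loops.Equi κ w) (hdur : X'.path.dur ≤ X.path.dur + α)
    (hF : ∀ m ∈ Set.Icc 0 X.path.dur, ∃ e ∈ F, |e.time - m| < η ∧ 5 * α < e.loop.dur)
    (hpath : ∀ s, ∀ s' ∈ Set.Icc 0 X'.path.dur, |s - s'| ≤ 4 * η →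
      dist (X.path.ext s) (X'.path.ext s') ≤ w)
    {t t' : ℝ} (htt : |t - t'| ≤ α) (ht : t ∈ Set.Icc 0 (X.totalTime lam))
    (ht' : t' ∈ Set.Icc 0 (X'.totalTime lam')) :
    dist (X.attachAt lam B t) (X'.attachAt lam' B' t') ≤ 5 * w + α := by
  have h2 := abs_le.1 htt
  rcases exists_isPosition (B := B) hX hE hw ht with ⟨s, hs, hsd⟩ | ⟨e, he1, he2⟩
  · rcases exists_isPosition (B := B') hX' hE' hw ht' with ⟨s', hs', hsd'⟩ | ⟨e', he1, he2⟩
    · have h3 := hpath s s' hs'.mem (M.abs_position_sub_le hη hdur hF htt hs hs')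
      have h4 := dist_triangle4 (X.attachAt lam B t) (X.path.ext s) (X'.path.ext s')
        (X'.attachAt lam' B' t')
      rw [dist_comm] at hsd'
      linarith
    · have hf' : B'.finish lam' e' = B'.start lam' e' + e'.loop.dur := rfl
      -- The loop lasts more than `2 * κ > α`, so it is matched. Starts, durations and times shift
      -- by at most `α` each, and the margin `κ ≥ 4 * α` keeps `t` inside the partner.
      obtain ⟨e, rfl⟩ : ∃ e, M.map e = e' := by
        by_contra! hcon
        linarith [M.dur_le' e' hcon]
      have h5 := abs_le.1 (M.start e)
      have h6 := abs_le.1 (M.dur e)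
      have hf : B.finish lam e.1 = B.start lam e.1 + e.1.loop.dur := rfl
      have := M.dist_attachAt_le_of_mem hX hX' hκ hE htt e ⟨by linarith, by linarith⟩
        ⟨by linarith, by linarith⟩
      linarith
  · have hf : B.finish lam e = B.start lam e + e.loop.dur := rfl
    have heF : e ∈ F := by
      by_contra hcon
      linarith [M.dur_le e hcon]
    have h5 := abs_le.1 (M.start ⟨e, heF⟩)
    have h6 := abs_le.1 (M.dur ⟨e, heF⟩)
    have hf' : B'.finish lam' (M.map ⟨e, heF⟩) =
      B'.start lam' (M.map ⟨e, heF⟩) + (M.map ⟨e, heF⟩).loop.dur := rfl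
    have := M.dist_attachAt_le_of_mem hX hX' hκ hE htt ⟨e, heF⟩ ⟨by linarith, by linarith⟩
      ⟨by linarith, by linarith⟩
    linarith

/-- Comparison of sums of two families, most of whose mass is carried by finitely many indices
which correspond to each other. -/
theorem abs_tsum_subtype_sub_le {ι ι' : Type*} {d : ι → ℝ} {d' : ι' → ℝ} (hd : Summable d)
    (hd' : Summable d') (h0 : ∀ i, 0 ≤ d i) (h0' : ∀ i, 0 ≤ d' i) {F : Finset ι} {ψ : F → ι'}
    (hψ : Function.Injective ψ) {p : ι → Prop} {p' : ι' → Prop} (hp : ∀ i : F, p' (ψ i) ↔ p i)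
    {η κ : ℝ} (hη : ∀ i : F, |d i - d' (ψ i)| ≤ η) (htot : |∑' i, d i - ∑' i, d' i| ≤ η)
    (htail : ∑' i, d i - ∑ i ∈ F, d i ≤ κ) :
    |∑' i : {i // p' i}, d' i - ∑' i : {i // p i}, d i| ≤ κ + (2 * F.card + 1) * η := by
  classical
  have a1 := sum_filter_le_tsum_subtype hd h0 F p
  have a2 := tsum_subtype_le_sum_filter_add hd h0 F p
  set F' := Finset.univ.map ⟨ψ, hψ⟩ with hF'
  have b1 := sum_filter_le_tsum_subtype hd' h0' F' p'
  have b2 := tsum_subtype_le_sum_filter_add hd' h0' F' p'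
  have hη0 : 0 ≤ η := (abs_nonneg _).trans htot
  have e1 : ∑ i ∈ F with p i, d i = ∑ i : F, if p i then d i else 0 := by
    rw [Finset.sum_filter]
    exact (Finset.sum_coe_sort F fun i => if p i then d i else 0).symm
  have e2 : ∑ i ∈ F' with p' i, d' i = ∑ i : F, if p i then d' (ψ i) else 0 := by
    rw [Finset.sum_filter, hF', Finset.sum_map]
    exact Finset.sum_congr rfl fun i _ => if_congr (hp i) rfl rfl
  have e3 : ∑ i ∈ F, d i = ∑ i : F, d i := (Finset.sum_coe_sort F d).symm
  have e4 : ∑ i ∈ F', d' i = ∑ i : F, d' (ψ i) := by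
    rw [hF', Finset.sum_map]
    rfl
  have key : ∀ f f' : F → ℝ, (∀ i, |f i - f' i| ≤ η) →
      |∑ i, f i - ∑ i, f' i| ≤ F.card * η := by
    intro f f' hff
    rw [← Finset.sum_sub_distrib]
    refine (Finset.abs_sum_le_sum_abs _ _).trans ?_
    refine (Finset.sum_le_card_nsmul _ _ η fun i _ => hff i).trans ?_
    simp
  have k1 := abs_le.1 (key (fun i => d i) (fun i => d' (ψ i)) hη)
  have k2 := abs_le.1 (key (fun i => if p i then d i else 0)
    (fun i => if p i then d' (ψ i) else 0) (fun i => by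
      by_cases h : p i
      · simpa [h] using hη i
      · simpa [h] using hη0))
  have k3 := abs_le.1 htot
  rw [e1] at a1 a2
  rw [e2] at b1 b2
  rw [e3] at a2 htail
  rw [e4] at b2
  -- The tail of `d'` is at most `κ + (card + 1) * η`, by comparing totals; the selected sums over
  -- `F` add another `card * η`.
  rw [abs_le]
  constructor <;> nlinarith [k1.1, k1.2, k2.1, k2.2]

end PathLoops

theorem exists_pos_forall_le {ι : Type*} (F : Finset ι) {f : ι → ℝ}
    (hf : ∀ i ∈ F, 0 < f i) : ∃ m : ℝ, 0 < m ∧ ∀ i ∈ F, m ≤ f i := by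
  rcases F.eq_empty_or_nonempty with rfl | hF
  · exact ⟨1, one_pos, by simp⟩
  · obtain ⟨i, hi, h⟩ := F.exists_min_image f hF
    exact ⟨f i, hf i hi, h⟩

/-! ### Real-valued consequences of closeness in the distance -/

namespace TimedFun

theorem dur_and_ext_close_of_dInf_le {f g : TimedFun} {δ : ℝ} (hδ : 0 ≤ δ)
    (h : f.dInf g ≤ ENNReal.ofReal δ) :
    |f.dur - g.dur| ≤ δ ∧ ∀ t : ℝ, dist (f.ext t) (g.ext t) ≤ δ := by
  have key : ∀ t : ℝ, 0 ≤ t → dist (f.ext t) (g.ext t) ≤ δ := fun t ht => by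
    rw [← edist_le_ofReal hδ]
    refine le_trans ?_ h
    exact (le_iSup (fun t : {t : ℝ // 0 ≤ t} => edist (f.ext t) (g.ext t)) ⟨t, ht⟩).trans
      le_add_self
  refine ⟨?_, fun t => ?_⟩
  · rw [← Real.dist_eq, ← edist_le_ofReal hδ]
    exact le_self_add.trans h
  · rcases le_total 0 t with ht | ht
    · exact key t ht
    · rw [f.ext_of_nonpos ht, g.ext_of_nonpos ht]
      exact key 0 le_rfl

theorem dInf_le_of_forall {f g : TimedFun} {a b : ℝ} (ha : 0 ≤ a) (hb : 0 ≤ b)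
    (hdur : |f.dur - g.dur| ≤ a) (h : ∀ t : ℝ, 0 ≤ t → dist (f.ext t) (g.ext t) ≤ b) :
    f.dInf g ≤ ENNReal.ofReal (a + b) := by
  rw [ENNReal.ofReal_add ha hb]
  refine add_le_add ?_ (iSup_le fun t => ?_)
  · rw [edist_le_ofReal ha, Real.dist_eq]
    exact hdur
  · rw [edist_le_ofReal hb]
    exact h t t.2

theorem exists_orderIso_of_rho_lt {f g : TimedFun} {δ : ℝ} (hδ : 0 ≤ δ)
    (h : f.rho g < ENNReal.ofReal δ) :
    ∃ φ : Set.Icc (0 : ℝ) f.dur ≃o Set.Icc (0 : ℝ) g.dur,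
      (∀ t, dist (f.toFun t) (g.toFun (φ t)) ≤ δ) ∧ ∀ t, |(φ t : ℝ) - t| ≤ 2 * δ := by
  obtain ⟨φ, hφ⟩ := iInf_lt_iff.1 h
  refine ⟨φ, fun t => ?_, fun t => ?_⟩
  · rw [← edist_le_ofReal hδ]
    exact (le_iSup (fun t => edist (f.toFun t) (g.toFun (φ t))) t).trans
      (le_self_add.trans hφ.le)
  · rw [← Real.dist_eq, ← edist_le_ofReal (by positivity)]
    have h1 : ((⨆ t, edist (φ t : ℝ) (t : ℝ)) + ⨆ s, edist (φ.symm s : ℝ) (s : ℝ)) / 2 ≤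
        ENNReal.ofReal δ := le_add_self.trans hφ.le
    rw [ENNReal.div_le_iff (by norm_num) (by norm_num)] at h1
    rw [mul_comm, ENNReal.ofReal_mul hδ]
    refine le_trans ?_ (h1.trans (by simp))
    exact (le_iSup (fun t => edist (φ t : ℝ) (t : ℝ)) t).trans le_self_add

theorem modulus_mono (f : TimedFun) {δ δ' : ℝ} (h : δ ≤ δ') : f.modulus δ ≤ f.modulus δ' :=
  iSup_mono fun _ => iSup_mono fun _ => iSup_mono' fun h' => ⟨h'.trans h, le_rfl⟩

end TimedFun

theorem LoopFamily.modulus_mono (L : LoopFamily) {δ δ' : ℝ} (h : δ ≤ δ') :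
    L.modulus δ ≤ L.modulus δ' :=
  iSup_mono fun e => e.1.toTimedFun.modulus_mono h

theorem LoopFamily.exists_deltaIso_of_d_lt {L L' : LoopFamily} {δ : ℝ}
    (h : L.d L' < ENNReal.ofReal δ) : ∃ δ' : ℝ, 0 < δ' ∧ δ' < δ ∧ Nonempty (DeltaIso δ' L L') := by
  obtain ⟨δ', h'⟩ := iInf_lt_iff.1 h
  obtain ⟨h0, h'⟩ := iInf_lt_iff.1 h'
  obtain ⟨hne, h'⟩ := iInf_lt_iff.1 h'
  exact ⟨δ', h0, (ENNReal.ofReal_lt_ofReal_iff_of_nonneg h0.le).1 h', hne⟩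

/-- The closeness of two pairs `𝒳` and `𝒳'` with precision `δ`, in terms of real numbers. -/
structure PathLoops.Near (X X' : PathLoops) (δ : ℝ) : Prop where
  path : ∃ φ : Set.Icc (0 : ℝ) X.path.dur ≃o Set.Icc (0 : ℝ) X'.path.dur,
    (∀ t, dist (X.path.toFun t) (X'.path.toFun (φ t)) ≤ δ) ∧ ∀ t, |(φ t : ℝ) - t| ≤ δ
  loops : ∃ δ' : ℝ, 0 < δ' ∧ δ' ≤ δ ∧ Nonempty (DeltaIso δ' X.loops X'.loops)
  total : |X.totalTime 0 - X'.totalTime 0| ≤ δ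
  modulus : ∀ κ ∈ Set.Icc (0 : ℝ) 1, X'.loops.modulus κ ≤ X.loops.modulus κ + ENNReal.ofReal δ

/-- One factor `2` makes the inequalities strict, so that near-optimal choices exist in the infima;
the other undoes the `1/2` in `rho`. -/
theorem PathLoops.near_of_dR0_le {X X' : PathLoops} {δ : ℝ} (hδ : 0 < δ)
    (h : X.dR0 X' ≤ ENNReal.ofReal δ) : X.Near X' (4 * δ) := by
  have hlt : ENNReal.ofReal δ < ENNReal.ofReal (2 * δ) :=
    (ENNReal.ofReal_lt_ofReal_iff_of_nonneg hδ.le).2 (by linarith)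
  unfold dR0 at h
  have h1 := le_self_add.trans h
  have h2 := le_self_add.trans h1
  refine ⟨?_, ?_, ?_, fun κ hκ => ?_⟩
  · obtain ⟨φ, hφ, hφ'⟩ := TimedFun.exists_orderIso_of_rho_lt (by positivity)
      ((le_self_add.trans h2).trans_lt hlt)
    exact ⟨φ, fun t => (hφ t).trans (by linarith), fun t => (hφ' t).trans (by linarith)⟩
  · obtain ⟨δ', h0, h', hne⟩ := LoopFamily.exists_deltaIso_of_d_lt
      ((le_add_self.trans h2).trans_lt hlt)
    exact ⟨δ', h0, by linarith, hne⟩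
  · rw [← Real.dist_eq]
    refine le_trans ?_ (by linarith : δ ≤ 4 * δ)
    rw [← edist_le_ofReal hδ.le]
    exact le_add_self.trans h1
  · have h3 : absDiff (X.loops.modulus κ) (X'.loops.modulus κ) ≤ ENNReal.ofReal (4 * δ) := by
      refine le_trans ?_ ((le_add_self.trans h).trans (ENNReal.ofReal_le_ofReal (by linarith)))
      exact le_iSup (fun κ : Set.Icc (0 : ℝ) 1 =>
        absDiff (X.loops.modulus κ) (X'.loops.modulus κ)) ⟨κ, hκ⟩
    exact tsub_le_iff_left.1 ((le_max_right _ _).trans h3)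

/-! ### Existence of matchings and the continuity estimate -/

namespace PathLoops

variable {X : PathLoops}

theorem totalTime_zero (X : PathLoops) : X.totalTime 0 = ∑' e : X.Hit, e.loop.dur := by
  simp [totalTime]

theorem Near.mono {X' : PathLoops} {δ δ₁ : ℝ} (h : X.Near X' δ) (hle : δ ≤ δ₁) :
    X.Near X' δ₁ := by
  obtain ⟨φ, h1, h2⟩ := h.path
  obtain ⟨δ', h3, h4, h5⟩ := h.loops
  exact ⟨⟨φ, fun t => (h1 t).trans hle, fun t => (h2 t).trans hle⟩, ⟨δ', h3, h4.trans hle, h5⟩,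
    h.total.trans hle, fun κ hκ =>
      (h.modulus κ hκ).trans (add_le_add le_rfl (ENNReal.ofReal_le_ofReal hle))⟩

theorem Near.dur_le {X' : PathLoops} {δ : ℝ} (h : X.Near X' δ) :
    X'.path.dur ≤ X.path.dur + δ := by
  obtain ⟨φ, -, hφ⟩ := h.path
  obtain ⟨s, hs⟩ := φ.surjective ⟨X'.path.dur, Set.right_mem_Icc.2 X'.path.dur_nonneg⟩
  have h1 := abs_le.1 (hφ s)
  rw [hs] at h1
  linarith [s.2.2, h1.2]

theorem MemR.exists_finset_dense (hX : X.MemR) {η : ℝ} (hη : 0 < η) :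
    ∃ F : Finset X.Hit, ∀ m ∈ Set.Icc 0 X.path.dur, ∃ e ∈ F, |e.time - m| < η := by
  obtain ⟨F, hF⟩ := isCompact_Icc.elim_finite_subcover
    (fun e : X.Hit => Metric.ball e.time η) (fun e => Metric.isOpen_ball)
    (s := Set.Icc 0 X.path.dur) fun m hm => by
      obtain ⟨_, ⟨e, rfl⟩, he⟩ := Metric.mem_closure_iff.1 (hX.dense_times hm) η hη
      exact Set.mem_iUnion.2 ⟨e, he⟩
  refine ⟨F, fun m hm => ?_⟩
  obtain ⟨e, he, hm⟩ := Set.mem_iUnion₂.1 (hF hm)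
  refine ⟨e, he, ?_⟩
  rw [abs_sub_comm]
  exact hm

theorem MemR.dur_pos (hX : X.MemR) (e : X.Hit) : 0 < e.loop.dur := (hX.regular e).dur_pos

/-- The loops of a finite set correspond to nearby loops in every nearby pair, with nearby hitting
times and roots. -/
theorem MemR.exists_match (hX : X.MemR) (B : TieBreak X) (F : Finset X.Hit) {η : ℝ} (hη : 0 < η) :
    ∃ δ : ℝ, 0 < δ ∧ ∀ X' : PathLoops, X.Near X' δ → ∃ ψ : F → X'.Hit, Function.Injective ψ ∧
      ∀ e : F, |(ψ e).time - e.1.time| ≤ η ∧ |e.1.loop.dur - (ψ e).loop.dur| ≤ η ∧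
        (∀ t, dist (e.1.loop.ext t) ((ψ e).loop.ext t) ≤ η) ∧
        ∀ B' : TieBreak X', |B'.root (ψ e) - B.root e.1| ≤ η := by
  choose δ hδ hst using fun e : X.Hit => (hX.regular e).stable (B.root_mem e) hη
  obtain ⟨m, hm, hm'⟩ := exists_pos_forall_le F fun e _ => hδ e
  obtain ⟨d, hd, hd'⟩ := exists_pos_forall_le F fun e _ => hX.dur_pos e
  -- Here `m` serves the stability of each loop of `F`, and `d`, a lower bound for their durations,
  -- puts them all in the source of the isomorphism.
  refine ⟨min η (min m d), by positivity, fun X' hN => ?_⟩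
  obtain ⟨φ, hφ, hφ'⟩ := hN.path
  obtain ⟨δ', hδ', hle, ⟨I⟩⟩ := hN.loops
  have hle1 : min η (min m d) ≤ η := min_le_left _ _
  have hle2 : min η (min m d) ≤ m := (min_le_right _ _).trans (min_le_left _ _)
  have hle3 : min η (min m d) ≤ d := (min_le_right _ _).trans (min_le_right _ _)
  have hsrc : ∀ e : F, e.1.1 ∈ I.source := fun e =>
    I.mem_source _ ((hle.trans hle3).trans (hd' e e.2))
  have hcl : ∀ e : F, |e.1.loop.dur - (I.toEquiv ⟨_, hsrc e⟩).1.1.dur| ≤ min η (min m d) ∧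
      ∀ t, dist (e.1.loop.ext t) ((I.toEquiv ⟨_, hsrc e⟩).1.1.ext t) ≤ min η (min m d) := by
    intro e
    refine TimedFun.dur_and_ext_close_of_dInf_le (by positivity) ((I.close ⟨_, hsrc e⟩).trans ?_)
    exact ENNReal.ofReal_le_ofReal (by linarith)
  have hall : ∀ e : F, Meets X'.path (I.toEquiv ⟨_, hsrc e⟩).1.1 ∧
      |firstHit X'.path (I.toEquiv ⟨_, hsrc e⟩).1.1 - e.1.time| ≤ η ∧
      ∀ θ' ∈ roots X'.path (I.toEquiv ⟨_, hsrc e⟩).1.1, |θ' - B.root e.1| ≤ η := by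
    intro e
    have hme := hle2.trans (hm' e.1 e.2)
    exact hst e.1 X'.path φ _ (fun t => (hφ t).trans hme) (fun t => (hφ' t).trans hme)
      ((hcl e).1.trans hme) fun t => ((hcl e).2 t).trans hme
  refine ⟨fun e => ⟨(I.toEquiv ⟨_, hsrc e⟩).1, (hall e).1⟩, fun e₁ e₂ h => ?_, fun e => ?_⟩
  · have h0 : (I.toEquiv ⟨_, hsrc e₁⟩).1 = (I.toEquiv ⟨_, hsrc e₂⟩).1 :=
      congrArg (fun e : X'.Hit => e.1) h
    have h1 := I.toEquiv.injective (Subtype.ext h0)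
    have h2 : e₁.1.1 = e₂.1.1 := congrArg (fun e : I.source => e.1) h1
    exact Subtype.ext (Subtype.ext h2)
  · exact ⟨(hall e).2.1, (hcl e).1.trans hle1, fun t => ((hcl e).2 t).trans hle1,
      fun B' => (hall e).2.2 _ (B'.root_mem _)⟩

theorem MemR.exists_finset_tail (hX : X.MemR) (F : Finset X.Hit) {κ : ℝ} (hκ : 0 < κ) :
    ∃ F', F ⊆ F' ∧ ∑' e : X.Hit, e.loop.dur - ∑ e ∈ F', e.loop.dur ≤ κ := by
  have h := hX.summable_dur.hasSum.eventually (lt_mem_nhds (sub_lt_self _ hκ))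
  obtain ⟨F', h1, h2⟩ := (h.and (Filter.eventually_ge_atTop F)).exists
  exact ⟨F', h2, by linarith⟩

theorem MemR.exists_separation (hX : X.MemR) (F : Finset X.Hit) :
    ∃ m : ℝ, 0 < m ∧ ∀ e ∈ F, ∀ e' ∈ F, e ≠ e' → m ≤ |e.time - e'.time| := by
  classical
  obtain ⟨m, hm, h⟩ := exists_pos_forall_le F.offDiag
    (f := fun p => |p.1.time - p.2.time|) fun p hp => by
      rw [Finset.mem_offDiag] at hp
      exact abs_pos.2 (sub_ne_zero.2 fun h => hp.2.2 (hX.injective_time h))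
  exact ⟨m, hm, fun e he e' he' hne => h (e, e') (Finset.mem_offDiag.2 ⟨he, he', hne⟩)⟩

/-- Matchings exist between a pair in `ℛ` and every nearby pair. -/
theorem MemR.exists_matching (hX : X.MemR) (B : TieBreak X) (F : Finset X.Hit) {α : ℝ}
    (hα : 0 < α) : ∃ F', F ⊆ F' ∧ ∃ δ : ℝ, 0 < δ ∧ ∀ (X' : PathLoops) (lam : ℝ),
      X'.MemR' lam → X.Near X' δ → lam ≤ δ → ∀ B' : TieBreak X',
        Nonempty (Matching B B' 0 lam α F') := by
  obtain ⟨F', hFF', htail⟩ := hX.exists_finset_tail F (κ := α / 3) (by positivity)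
  obtain ⟨m, hm, hsep⟩ := hX.exists_separation F'
  have hc : (0 : ℝ) < 2 * F'.card + 1 := by positivity
  -- The first bound makes the finite comparison cost at most `α / 3`, on top of the tail `α / 3`;
  -- the second preserves strict order of hitting times separated by `m`.
  set η := min (α / (3 * (2 * F'.card + 1))) (m / 3) with hη
  have hη0 : 0 < η := by positivity
  have hη1 : (2 * F'.card + 1) * η ≤ α / 3 := by
    have h1 : η ≤ α / (3 * (2 * F'.card + 1)) := min_le_left _ _
    rw [le_div_iff₀ (by positivity)] at h1
    linarith
  have hηα : η ≤ α := by nlinarith [(Nat.cast_nonneg F'.card : (0 : ℝ) ≤ F'.card)]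
  have hη2 : η ≤ m / 3 := min_le_right _ _
  obtain ⟨δ, hδ, hmatch⟩ := hX.exists_match B F' hη0
  have hdur := X.path.dur_nonneg
  set δ₁ := min (min δ η) (min 1 (α / (3 * (X.path.dur + 1)))) with hδ₁
  have hd1 : δ₁ ≤ δ := (min_le_left _ _).trans (min_le_left _ _)
  have hd2 : δ₁ ≤ η := (min_le_left _ _).trans (min_le_right _ _)
  have hd3 : δ₁ ≤ 1 := (min_le_right _ _).trans (min_le_left _ _)
  have hd4 : δ₁ ≤ α / (3 * (X.path.dur + 1)) := (min_le_right _ _).trans (min_le_right _ _)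
  refine ⟨F', hFF', δ₁, by positivity, fun X' lam hX' hN hlam B' => ?_⟩
  obtain ⟨ψ, hψ, hall⟩ := hmatch X' (hN.mono hd1)
  have htot : |∑' e : X.Hit, e.loop.dur - ∑' e : X'.Hit, e.loop.dur| ≤ η := by
    rw [← totalTime_zero, ← totalTime_zero]
    exact hN.total.trans hd2
  have hcmp : ∀ (p : X.Hit → Prop) (p' : X'.Hit → Prop), (∀ e : F', p' (ψ e) ↔ p e) →
      |∑' e : {e // p' e}, e.1.loop.dur - ∑' e : {e // p e}, e.1.loop.dur| ≤
        α / 3 + α / 3 := by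
    intro p p' hp
    refine (abs_tsum_subtype_sub_le hX.summable_dur hX'.memR0.summable_dur
      (fun e => e.loop.dur_nonneg) (fun e => e.loop.dur_nonneg) hψ hp
      (fun e => (hall e).2.1) htot htail).trans ?_
    linarith
  have htime : ∀ e₁ e₂ : F', e₁.1.time < e₂.1.time → (ψ e₁).time < (ψ e₂).time := by
    intro e₁ e₂ h
    have h1 := hsep e₁ e₁.2 e₂ e₂.2 fun h' => h.ne (congrArg Hit.time h')
    rw [abs_of_neg (sub_neg.2 h)] at h1
    have h2 := abs_le.1 (hall e₁).1
    have h3 := abs_le.1 (hall e₂).1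
    linarith
  have hprec : ∀ e₁ e₂ : F', B'.prec (ψ e₁) (ψ e₂) ↔ B.prec e₁ e₂ := by
    intro e₁ e₂
    rcases lt_trichotomy e₁.1.time e₂.1.time with h | h | h
    · exact ⟨fun _ => Or.inl h, fun _ => Or.inl (htime _ _ h)⟩
    · obtain rfl : e₁ = e₂ := Subtype.ext (hX.injective_time h)
      exact iff_of_false (prec_irrefl B' _) (prec_irrefl B _)
    · refine iff_of_false (fun h' => ?_) fun h' => ?_
      · exact absurd (prec_time_le h') (not_le.2 (htime _ _ h))
      · exact absurd (prec_time_le h') (not_le.2 h)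
  refine ⟨⟨ψ, fun e he => ?_, fun e' he' => ?_, fun e => (hall e).1.trans hηα,
    fun e => ((hall e).2.2.2 B').trans hηα, fun e => (hall e).2.1.trans hηα,
    fun e t => ((hall e).2.2.1 t).trans hηα, fun e => ?_⟩⟩
  · classical
    have h1 := hX.summable_dur.sum_le_tsum (insert e F') fun e _ => e.loop.dur_nonneg
    rw [Finset.sum_insert he] at h1
    linarith
  -- An unmatched loop is the whole of a sum whose counterpart in `X` is empty, so its duration is
  -- at most `2 * α / 3`.
  · have h1 := hcmp (fun _ => False) (fun e => e = e') fun e => iff_of_false (he' e) id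
    have h2 : ∑' e : {e // e = e'}, e.1.loop.dur = e'.loop.dur :=
      tsum_singleton e' fun e : X'.Hit => e.loop.dur
    rw [h2, tsum_empty, sub_zero] at h1
    linarith [le_abs_self e'.loop.dur]
  -- The durations before the loop contribute `2 * α / 3`, the term `lam * σ` the last third.
  · have h1 := abs_le.1 (hcmp (fun i => B.prec i e) (fun i => B'.prec i (ψ e)) fun i => hprec i e)
    have h2 := (ψ e).time_mem
    have h3 : lam * (ψ e).time ≤ α / 3 := by
      have h4 : (ψ e).time ≤ X.path.dur + 1 := by linarith [hN.dur_le, h2.2]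
      calc lam * (ψ e).time ≤ (α / (3 * (X.path.dur + 1))) * (X.path.dur + 1) :=
            mul_le_mul (hlam.trans hd4) h4 h2.1 (by positivity)
        _ = α / 3 := by field_simp
    have h4 := mul_nonneg hX'.nonneg h2.1
    unfold TieBreak.start
    rw [zero_mul, add_zero, abs_le]
    constructor <;> linarith

theorem dist_ext_path_le_of_near {X' : PathLoops} {δ w η : ℝ} (hN : X.Near X' δ)
    (hunif : ∀ u v : ℝ, |u - v| < η → dist (X.path.ext u) (X.path.ext v) ≤ w) {s s' : ℝ}
    (hs' : s' ∈ Set.Icc 0 X'.path.dur) (hss : |s - s'| + δ < η) :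
    dist (X.path.ext s) (X'.path.ext s') ≤ w + δ := by
  obtain ⟨φ, h1, h2⟩ := hN.path
  obtain ⟨u, hu⟩ := φ.surjective ⟨s', hs'⟩
  have h3 := h1 u
  have h4 := h2 u
  rw [hu, ← X.path.ext_coe, ← X'.path.ext_coe] at h3
  rw [hu] at h4
  have h5 := hunif s u (by
    have := abs_sub_le s s' u
    exact (this.trans (add_le_add le_rfl h4)).trans_lt hss)
  exact (dist_triangle _ _ _).trans (add_le_add h5 h3)

theorem attach_ext_eq {lam : ℝ} (hlam : 0 ≤ lam) (B : TieBreak X) {t : ℝ} (ht : 0 ≤ t) :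
    (X.attach lam hlam B).ext t = X.attachAt lam B (min (X.totalTime lam) t) := by
  have h0 := X.totalTime_nonneg hlam
  change X.attachAt lam B (max 0 (min (X.totalTime lam) t)) = _
  rw [max_eq_right (le_min h0 ht)]

theorem MemR.exists_attach_dInf_le (hX : X.MemR) (B : TieBreak X) {w : ℝ} (hw : 0 < w) :
    ∃ δ : ℝ, 0 < δ ∧ ∀ (X' : PathLoops) (lam : ℝ) (h' : X'.MemR' lam), X.Near X' δ → lam ≤ δ →
      ∀ B' : TieBreak X', (X'.attach lam h'.nonneg B').dInf (X.attach 0 le_rfl B) ≤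
        ENNReal.ofReal (w + 6 * w) := by
  obtain ⟨κ₀, hκ₀, hmod⟩ := hX.equicontinuous (ENNReal.ofReal (w / 2)) (by simpa using hw)
  -- The moduli of the two families are compared only at scales in `[0, 1]`.
  set κ := min κ₀ 1 with hκdef
  have hκ : 0 < κ := by positivity
  have hmod' : X.loops.modulus κ ≤ ENNReal.ofReal (w / 2) :=
    (X.loops.modulus_mono (min_le_left _ _)).trans hmod.le
  have hE : X.loops.Equi κ w := LoopFamily.equi_of_modulus_le hw.le
    (hmod'.trans (ENNReal.ofReal_le_ofReal (by linarith)))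
  have huc : UniformContinuous X.path.ext :=
    (CompactSpace.uniformContinuous_of_continuous X.path.continuous_toFun).comp
      (LipschitzWith.projIcc X.path.dur_nonneg).uniformContinuous
  obtain ⟨η₁, hη₁, hunif⟩ := Metric.uniformContinuous_iff.1 huc (w / 2) (half_pos hw)
  -- Positions `4 * η` apart, displaced further by the reparametrisation by at most `δ ≤ η / 2`,
  -- remain closer than `η₁`.
  set η := η₁ / 6 with hη
  have hη0 : 0 < η := by positivity
  obtain ⟨F₀, hF₀⟩ := hX.exists_finset_dense hη0
  obtain ⟨d, hd, hd'⟩ := exists_pos_forall_le F₀ fun e _ => hX.dur_pos e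
  -- The bound `κ / 4` is for rerooting, and `d / 6` gives `5 * α < d` for the loops of the net.
  set α := min (min w η) (min (κ / 4) (d / 6)) with hα
  have hα0 : 0 < α := by positivity
  have ha1 : α ≤ w := (min_le_left _ _).trans (min_le_left _ _)
  have ha2 : α ≤ η := (min_le_left _ _).trans (min_le_right _ _)
  have ha3 : α ≤ κ / 4 := (min_le_right _ _).trans (min_le_left _ _)
  have ha4 : α ≤ d / 6 := (min_le_right _ _).trans (min_le_right _ _)
  obtain ⟨F, hF₀F, δ₀, hδ₀, hmatch⟩ := hX.exists_matching B F₀ hα0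
  have hdur0 := X.path.dur_nonneg
  set δ₁ := min (min δ₀ 1) (min (α / 2) (α / (2 * (X.path.dur + 1)))) with hδ₁
  set δ := min δ₁ (w / 2) with hδ
  have hdδ : δ ≤ δ₁ := min_le_left _ _
  have hd1 : δ ≤ δ₀ := hdδ.trans ((min_le_left _ _).trans (min_le_left _ _))
  have hd2 : δ ≤ 1 := hdδ.trans ((min_le_left _ _).trans (min_le_right _ _))
  have hd3 : δ ≤ α / 2 := hdδ.trans ((min_le_right _ _).trans (min_le_left _ _))
  have hd4 : δ ≤ α / (2 * (X.path.dur + 1)) :=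
    hdδ.trans ((min_le_right _ _).trans (min_le_right _ _))
  have hd5 : δ ≤ w / 2 := min_le_right _ _
  refine ⟨δ, by positivity, fun X' lam hX' hN hlam B' => ?_⟩
  obtain ⟨M⟩ := hmatch X' lam hX' (hN.mono hd1) (hlam.trans hd1) B'
  have hE' : X'.loops.Equi κ w := by
    refine LoopFamily.equi_of_modulus_le hw.le
      ((hN.modulus κ ⟨hκ.le, min_le_right _ _⟩).trans ?_)
    refine (add_le_add hmod' (ENNReal.ofReal_le_ofReal hd5)).trans ?_
    rw [← ENNReal.ofReal_add (by positivity) (by positivity), add_halves]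
  have hlam0 := hX'.nonneg
  have htot : |X'.totalTime lam - X.totalTime 0| ≤ α := by
    have h1 := abs_le.1 hN.total
    have h2 : X'.totalTime lam = X'.totalTime 0 + lam * X'.path.dur := by
      simp [totalTime]
    have h3 : lam * X'.path.dur ≤ α / 2 := by
      have h4 : X'.path.dur ≤ X.path.dur + 1 := by linarith [hN.dur_le]
      calc lam * X'.path.dur ≤ (α / (2 * (X.path.dur + 1))) * (X.path.dur + 1) :=
            mul_le_mul (hlam.trans hd4) h4 X'.path.dur_nonneg (by positivity)
        _ = α / 2 := by field_simp
    have h4 := mul_nonneg hlam0 X'.path.dur_nonneg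
    rw [h2, abs_le]
    constructor <;> linarith
  refine TimedFun.dInf_le_of_forall hw.le (by positivity) (htot.trans ha1) fun t ht => ?_
  rw [attach_ext_eq hlam0 B' ht, attach_ext_eq le_rfl B ht, dist_comm]
  have htot' := htot
  rw [abs_sub_comm] at htot'
  refine (M.dist_attachAt_le (Or.inl ⟨hX, rfl⟩) hX' hα0 (κ := κ) (w := w) (η := η) (by linarith)
    hw.le ha2 hE hE' (by linarith [hN.dur_le]) ?_ ?_ ?_ ?_ ?_).trans (by linarith)
  · intro m hm
    obtain ⟨e, he, hem⟩ := hF₀ m hm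
    exact ⟨e, hF₀F he, hem, by linarith [hd' e he]⟩
  · intro s s' hs' hss
    refine (dist_ext_path_le_of_near hN (η := η₁) (w := w / 2) (fun u v huv => (hunif huv).le) hs'
      ?_).trans (by linarith)
    linarith
  · refine (abs_min_sub_min_le_max _ _ _ _).trans (max_le htot' ?_)
    simpa using hα0.le
  · exact ⟨le_min (X.totalTime_nonneg le_rfl) ht, min_le_left _ _⟩
  · exact ⟨le_min (X'.totalTime_nonneg hlam0) ht, min_le_left _ _⟩

end PathLoops

end LoopAttachment

theorem theorem4p11 (X : LoopAttachment.PathLoops) (hX : X.MemR) (ε : ℝ) (hε : 0 < ε) :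
    ∃ δ : ℝ, 0 < δ ∧
      ∀ (X' : LoopAttachment.PathLoops) (lam : ℝ) (h' : X'.MemR' lam),
        X.dR0 X' ≤ ENNReal.ofReal δ → lam ≤ δ →
          ∀ B : X'.TieBreak, (X'.attach lam h'.nonneg B).dInf hX.attach < ENNReal.ofReal ε := by
  -- With `w = ε / 8`, durations cost `w` and values `5 * w + α ≤ 6 * w`, for a total of `7 * ε /
  -- 8`.
  obtain ⟨δ, hδ, h⟩ := hX.exists_attach_dInf_le
    (Classical.choice (LoopAttachment.PathLoops.TieBreak.nonempty X)) (w := ε / 8) (by positivity)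
  refine ⟨δ / 4, by positivity, fun X' lam h' hd hlam B => ?_⟩
  have hN := LoopAttachment.PathLoops.near_of_dR0_le (by positivity : 0 < δ / 4) hd
  rw [mul_div_cancel₀ _ (by norm_num : (4 : ℝ) ≠ 0)] at hN
  refine (h X' lam h' hN (by linarith) B).trans_lt ?_
  exact (ENNReal.ofReal_lt_ofReal_iff hε).2 (by linarith)
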